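/- Let $\Gamma\subset\mathrm{PSL}_2(\mathbb R)$ be a Fuchsian group of the first kind (a discrete subgroup such that $M=\Gamma\backslash\mathbb H$ has finite hyperbolic volume), and let $d_{\mathrm{hyp}}$ be the hyperbolic distance on the upper half-plane $\mathbb H$ and $u(z,w)=\frac{|z-w|^2}{4\,\mathrm{Im}(z)\,\mathrm{Im}(w)}$. Let $k(z,w)=k(u(z,w))$ be a point-pair invariant with automorphic kernel $K(z,w)=\sum_{\eta\in\Gamma}k(u(z,\eta w))$. Suppose that its Selberg/Harish-Chandra transform exists, i.e. that the integrals $$Q(v)=\int_v^\infty\frac{k(u)}{\sqrt{u-v}}\,du\ (v>0),\qquad g(u)=2\,Q\bigl(\sinh^2(u/2)\bigr),\qquad h(r)=\int_{-\infty}^\infty g(u)e^{iru}\,du\ (r\in\mathbb R)$$ converge absolutely, and that for some $\varepsilon>0$ the function $h$ extends to the strip $|\mathrm{Im}(r)|\le\frac12+\varepsilon$ so that there (S1) $h$ is even, (S2) $h$ is holomorphic, and $h(r)=O\bigl((1+|r|)^{-2}\bigr)$ as $r\to\infty$ in the strip. Assume furthermore that, for all $z,w\in\mathbb H$ with distinct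 images in $M$, $$K(z,w)=\frac1{4\pi}\sum_{\eta\in\Gamma}\int_{-\infty}^\infty r\tanh(\pi r)\,h(r)\,P_{-\frac12+ir}\bigl(\cosh d_{\mathrm{hyp}}(z,\eta w)\bigr)\,dr,$$ where $P_\nu$ is the Legendre function of the first kind. Then, for every $\delta$ with $0<\delta<\frac12$ and $\delta\le\varepsilon$, and all $z,w\in\mathbb H$ with distinct images in $M$, $$K(z,w)=\frac{1}{2\pi^{3/2}\,i}\int_{\mathrm{Re}(\nu)=1+\delta}\frac{2^{-\nu}\,\Gamma(\nu)}{\Gamma(\nu-\frac12)}\,h\Bigl(i\Bigl(\frac12-\nu\Bigr)\Bigr)\,\mathcal K_\nu(z,w)\,d\nu,$$ where $$\mathcal K_\nu(z,w)=\sum_{k=0}^\infty\frac{b_k(\nu)}{k!}K_{\nu+2k}(z,w),\qquad b_k(\nu)=\frac{(\frac{\nu}{2})_k(\frac{\nu+1}{2})_k}{(\nu+\frac12)_k},\qquad K_s(z,w)=\sum_{\eta\in\Gamma}\cosh\bigl(d_{\mathrm{hyp}}(z,\eta w)\bigr)^{-s},$$ $(a)_k=a(a+1)\cdots(a+k-1)$,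 and the integral and, for $\mathrm{Re}(\nu)=1+\delta$, the series defining $K_{\nu+2k}(z,w)$ and $\mathcal K_\nu(z,w)$ converge absolutely. -/

import Mathlib

noncomputable section

namespace HypKernel

open MeasureTheory
open Complex (I)
open scoped MatrixGroups UpperHalfPlane

/-! ### The hyperbolic surface -/

/-- The group `PSL₂(ℝ)`, with the quotient topology. -/
abbrev PSL2R : Type := Matrix.ProjectiveSpecialLinearGroup (Fin 2) ℝ

theorem smul_eq_of_mem_center (g : SL(2, ℝ)) (hg : g ∈ Subgroup.center SL(2, ℝ)) (z : ℍ) :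
    g • z = z := by
  obtain ⟨r, hr, hrg⟩ := Matrix.SpecialLinearGroup.mem_center_iff.mp hg
  have hr0 : (r : ℂ) ≠ 0 := by
    rintro h0
    have : r = 0 := by exact_mod_cast h0
    simp [this] at hr
  ext1
  rw [UpperHalfPlane.coe_specialLinearGroup_apply]
  simp [← hrg, hr0]

/-- The action of `PSL₂(ℝ)` on `ℍ` by fractional linear transformations, as a homomorphism. -/
def pslToPerm : PSL2R →* Equiv.Perm ℍ :=
  QuotientGroup.lift _ (MulAction.toPermHom SL(2, ℝ) ℍ) fun g hg =>
    Equiv.ext fun z => smul_eq_of_mem_center g hg z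

/-- `PSL₂(ℝ)` acts on the upper half-plane by fractional linear transformations. -/
instance : MulAction PSL2R ℍ := MulAction.compHom ℍ pslToPerm

theorem coe_smul_eq (g : SL(2, ℝ)) (z : ℍ) : (QuotientGroup.mk g : PSL2R) • z = g • z := rfl

/-- Fuchsian groups of the first kind: discrete subgroups `Γ` of `PSL₂(ℝ)` such that `Γ \ ℍ` has
finite hyperbolic volume (`volume` on `ℍ` is `dx dy / y ^ 2`). -/
structure IsFuchsianFirstKind (Γ : Subgroup PSL2R) : Prop where
  discrete : DiscreteTopology Γ
  finite_volume : ∃ F : Set ℍ, IsFundamentalDomain Γ F ∧ volume F < ⊤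

/-- The surface `M = Γ \ ℍ`. -/
abbrev Surface (Γ : Subgroup PSL2R) : Type := MulAction.orbitRel.Quotient Γ ℍ

/-- The natural projection `ℍ → M`. -/
def proj (Γ : Subgroup PSL2R) (z : ℍ) : Surface Γ := Quotient.mk _ z

/-- The displacement `u(z, w) = |z - w|² / (4 Im z Im w)`. -/
def u (z w : ℍ) : ℝ := ‖(z : ℂ) - w‖ ^ 2 / (4 * z.im * w.im)

/-- The automorphic kernel `K(z, w) = ∑_{η ∈ Γ} k(u(z, η w))` of the point-pair invariant
`(z, w) ↦ k(u(z, w))`. -/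
def automorphicKernel (Γ : Subgroup PSL2R) (k : ℝ → ℂ) (z w : ℍ) : ℂ :=
  ∑' η : Γ, k (u z (η • w))

/-! ### The Selberg/Harish-Chandra transform -/

/-- `Q(v) = ∫_v^∞ k(u) (u - v)^{-1/2} du`. -/
def selbergQ (k : ℝ → ℂ) (v : ℝ) : ℂ := ∫ u in Set.Ioi v, k u / (√(u - v) : ℂ)

/-- `g(u) = 2 Q(sinh²(u/2))`. -/
def selbergG (k : ℝ → ℂ) (u : ℝ) : ℂ := 2 * selbergQ k (Real.sinh (u / 2) ^ 2)

/-- The Selberg/Harish-Chandra transform of `k` exists and is given on the real line by `h`, i.e.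
`h(r) = ∫ g(u) e^{iru} du`. Since `h` is a function on `ℂ`, its values off the real line are pinned
down by a holomorphy assumption on a strip. -/
structure HasSelbergTransform (k : ℝ → ℂ) (h : ℂ → ℂ) : Prop where
  integrableOn_Q : ∀ v > 0, IntegrableOn (fun u : ℝ => k u / (√(u - v) : ℂ)) (Set.Ioi v)
  integrable_g : Integrable (selbergG k)
  eq_integral : ∀ r : ℝ, h r = ∫ u : ℝ, selbergG k u * Complex.exp (I * r * u)

/-- The closed strip `|Im r| ≤ 1/2 + ε`. -/
def strip (ε : ℝ) : Set ℂ := {r | |r.im| ≤ 1 / 2 + ε}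

/-! ### The Legendre function -/

/-- The Legendre function of the first kind `P_ν(x)`, for real `x ≥ 1` and complex degree `ν`,
by Laplace's integral
`P_ν(x) = π⁻¹ ∫_0^π (x + √(x² - 1) cos φ)^ν dφ` (the base of the power is positive). -/
def legendreP (ν : ℂ) (x : ℝ) : ℂ :=
  (Real.pi : ℂ)⁻¹ * ∫ φ in (0 : ℝ)..Real.pi, ((x + √(x ^ 2 - 1) * Real.cos φ : ℝ) : ℂ) ^ ν

/-- `(4π)⁻¹ ∑_{η ∈ Γ} ∫ r tanh(πr) h(r) P_{-1/2 + ir}(cosh d(z, η w)) dr`. -/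
def mehlerFockKernel (Γ : Subgroup PSL2R) (h : ℂ → ℂ) (z w : ℍ) : ℂ :=
  1 / (4 * Real.pi) * ∑' η : Γ, ∫ r : ℝ, (r * Real.tanh (Real.pi * r) : ℂ) * h r *
    legendreP (-1 / 2 + I * r) (Real.cosh (dist z (η • w)))

/-! ### The kernels `K_s` and `𝒦_ν` -/

/-- The term `cosh(d(z, η w))^{-s}`. -/
def coshTerm (Γ : Subgroup PSL2R) (s : ℂ) (z w : ℍ) (η : Γ) : ℂ :=
  (Real.cosh (dist z (η • w)) : ℂ) ^ (-s)

/-- `K_s(z, w) = ∑_{η ∈ Γ} cosh(d(z, η w))^{-s}`. -/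
def coshKernel (Γ : Subgroup PSL2R) (s : ℂ) (z w : ℍ) : ℂ := ∑' η : Γ, coshTerm Γ s z w η

/-- The Pochhammer symbol `(a)_k = a (a + 1) ⋯ (a + k - 1)`. -/
def poch (a : ℂ) (k : ℕ) : ℂ := (ascPochhammer ℂ k).eval a

/-- `b_k(ν) = (ν/2)_k ((ν+1)/2)_k / (ν+1/2)_k`. -/
def b (k : ℕ) (ν : ℂ) : ℂ := poch (ν / 2) k * poch ((ν + 1) / 2) k / poch (ν + 1 / 2) k

/-- The term `b_k(ν) / k! · K_{ν+2k}(z, w)`. -/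
def calKTerm (Γ : Subgroup PSL2R) (ν : ℂ) (z w : ℍ) (k : ℕ) : ℂ :=
  b k ν / (Nat.factorial k : ℂ) * coshKernel Γ (ν + 2 * k) z w

/-- `𝒦_ν(z, w) = ∑_{k ≥ 0} b_k(ν) / k! · K_{ν+2k}(z, w)`. -/
def calK (Γ : Subgroup PSL2R) (ν : ℂ) (z w : ℍ) : ℂ := ∑' k : ℕ, calKTerm Γ ν z w k

/-- The integrand `2^{-ν} Γ(ν) / Γ(ν - 1/2) · h(i(1/2 - ν)) · 𝒦_ν(z, w)`. -/
def integrand (Γ : Subgroup PSL2R) (h : ℂ → ℂ) (z w : ℍ) (ν : ℂ) : ℂ :=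
  (2 : ℂ) ^ (-ν) * Complex.Gamma ν / Complex.Gamma (ν - 1 / 2) * h (I * (1 / 2 - ν)) *
    calK Γ ν z w

/-- Absolute convergence of the integral of `f` along the line `Re ν = σ`. -/
def VerticalIntegrable (f : ℂ → ℂ) (σ : ℝ) : Prop := Integrable fun t : ℝ => f (σ + t * I)

/-- The integral `∫_{Re ν = σ} f(ν) dν` along the vertical line, oriented upwards. -/
def verticalIntegral (f : ℂ → ℂ) (σ : ℝ) : ℂ := I * ∫ t : ℝ, f (σ + t * I)

end HypKernel

end

/-!
With `a = e^{-d}`, the Legendre functions `P_{-1/2+ir}(cosh d)` and `Q_{-1/2±ir}(cosh d)` are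
integrals of `x ^ (-1/2+ir) / √((x - a) (x - a⁻¹))` between consecutive branch points `0`, `a`,
`a⁻¹`, `∞`. Cauchy's theorem in the upper half-plane, together with complex conjugation, gives
`Q_{-1/2-ir} - Q_{-1/2+ir} = iπ tanh(πr) P_{-1/2+ir}`. As `r h(r)` is odd, each term of the
Mehler–Fock kernel becomes an integral of `r h(r) Q_{-1/2+ir}(cosh d)`, which is holomorphic and
`O(|r|^{-3/2})` for `-(1/2+δ) ≤ Im r ≤ 0`. The contour therefore moves to `Re ν = 1 + δ`, where
`ν = 1/2 + ir` and `Q_{ν-1}(cosh d(z, η w))` is dominated by `e^{-(1+δ) d(z, η w)}`, hence summable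
over `Γ`. Expanding `Q_{ν-1}` in descending powers of `cosh d` (a quadratic substitution and the
binomial series) produces `𝒦_ν`.
-/

noncomputable section

namespace HypKernel

open Filter MeasureTheory Topology
open scoped MatrixGroups UpperHalfPlane

/-! ### Convergence of `K_s` for `Re s > 1` -/

theorem countable_of_discreteTopology (Γ : Subgroup PSL2R) [DiscreteTopology Γ] : Countable Γ := by
  have : SecondCountableTopology (Matrix (Fin 2) (Fin 2) ℝ) :=
    inferInstanceAs (SecondCountableTopology (Fin 2 → Fin 2 → ℝ))
  have : SecondCountableTopology SL(2, ℝ) :=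
    (Topology.IsEmbedding.subtypeVal
      (p := fun A : Matrix (Fin 2) (Fin 2) ℝ => A.det = 1)).secondCountableTopology
  have : SecondCountableTopology PSL2R := QuotientGroup.instSecondCountableTopology _
  exact countable_of_Lindelof_of_discrete

instance : IsIsometricSMul PSL2R ℍ where
  isometry_smul g := by
    obtain ⟨g, rfl⟩ := QuotientGroup.mk_surjective g
    exact isometry_smul ℍ g

instance (Γ : Subgroup PSL2R) : IsIsometricSMul Γ ℍ where
  isometry_smul η := isometry_smul ℍ (η : PSL2R)

instance : SMulInvariantMeasure PSL2R ℍ volume where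
  measure_preimage_smul g s _ := by
    obtain ⟨g, rfl⟩ := QuotientGroup.mk_surjective g
    exact measure_preimage_smul volume (g : GL (Fin 2) ℝ) s

theorem volume_univ_pos : 0 < (volume : Measure ℍ) Set.univ := by
  have hsupp : Set.range UpperHalfPlane.coe ⊆
      Function.support fun c : ℂ => (((1 / ‖c.im‖₊) ^ 2 : NNReal) : ENNReal) := by
    rintro _ ⟨v, rfl⟩
    simp [v.im_ne_zero]
  rw [UpperHalfPlane.volume_eq_lintegral, Set.image_univ,
    setLIntegral_pos_iff (by fun_prop), Set.inter_eq_right.2 hsupp]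
  exact UpperHalfPlane.isOpenEmbedding_coe.isOpen_range.measure_pos volume (Set.range_nonempty _)

theorem lintegral_re_mul_im {f g : ℝ → ENNReal} (hf : Measurable f) (hg : Measurable g) :
    ∫⁻ v : ℍ, f v.re * g v.im =
      (∫⁻ x, f x) * ∫⁻ y in Set.Ioi 0, ENNReal.ofReal ((1 / y) ^ 2) * g y := by
  set φ : ℝ → ENNReal := fun y => ENNReal.ofReal ((1 / y) ^ 2) * g y
  have hφ : Measurable φ := by fun_prop
  have hdensity_meas : Measurable fun v : ℍ =>
      (((1 / NNReal.mk v.im v.im_pos.le : NNReal) ^ 2 : NNReal) : ENNReal) := by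
    refine measurable_coe_nnreal_ennreal.comp (Measurable.pow_const (Measurable.div ?_ ?_) _)
    · exact measurable_const
    · exact (UpperHalfPlane.continuous_im.subtype_mk _).measurable
  have hdensity (v : ℍ) : (((1 / NNReal.mk v.im v.im_pos.le : NNReal) ^ 2 : NNReal) : ENNReal) =
      ENNReal.ofReal ((1 / v.im) ^ 2) := by
    rw [ENNReal.ofReal, ENNReal.coe_inj]
    ext
    rw [Real.coe_toNNReal _ (sq_nonneg _)]
    simp
  have hfg : Measurable fun v : ℍ => f v.re * g v.im :=
    (hf.comp UpperHalfPlane.continuous_re.measurable).mul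
      (hg.comp UpperHalfPlane.continuous_im.measurable)
  have hrange : (Set.range UpperHalfPlane.coe : Set ℂ) =
      Complex.measurableEquivRealProd ⁻¹' Set.univ ×ˢ Set.Ioi 0 := by
    ext c
    simp [UpperHalfPlane.range_coe, Complex.measurableEquivRealProd]
  calc ∫⁻ v : ℍ, f v.re * g v.im
      = ∫⁻ v : ℍ, (fun c : ℂ => f c.re * φ c.im) v ∂(volume.comap UpperHalfPlane.coe) := by
        rw [UpperHalfPlane.volume_def, lintegral_withDensity_eq_lintegral_mul _ hdensity_meas hfg]
        refine lintegral_congr fun v => ?_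
        simp only [Pi.mul_apply, hdensity, φ, UpperHalfPlane.coe_im, UpperHalfPlane.coe_re]
        ring
    _ = ∫⁻ c in Set.range UpperHalfPlane.coe, f c.re * φ c.im := by
        rw [← UpperHalfPlane.measurableEmbedding_coe.lintegral_map (fun c : ℂ => f c.re * φ c.im),
          UpperHalfPlane.measurableEmbedding_coe.map_comap]
    _ = ∫⁻ p in Set.univ ×ˢ Set.Ioi 0, f p.1 * φ p.2 := by
        rw [hrange]
        exact Complex.volume_preserving_equiv_real_prod.setLIntegral_comp_preimage_emb
          Complex.measurableEquivRealProd.measurableEmbedding (fun p => f p.1 * φ p.2) _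
    _ = (∫⁻ x, f x) * ∫⁻ y in Set.Ioi 0, φ y := by
        rw [Measure.volume_eq_prod, ← Measure.prod_restrict, Measure.restrict_univ]
        exact lintegral_prod_mul hf.aemeasurable hφ.aemeasurable

theorem integrableOn_rpow_mul_one_add_sq_rpow {s : ℝ} (hs : 1 < s) :
    IntegrableOn (fun y : ℝ => y ^ (s - 2) * (1 + y ^ 2) ^ (-s / 2)) (Set.Ioi 0) := by
  have hm : Measurable fun y : ℝ => y ^ (s - 2) * (1 + y ^ 2) ^ (-s / 2) := by fun_prop
  rw [← Set.Ioc_union_Ioi_eq_Ioi zero_le_one, integrableOn_union]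
  constructor
  · have h_dom : IntegrableOn (fun y : ℝ => y ^ (s - 2)) (Set.Ioc 0 1) := by
      rw [integrableOn_Ioc_iff_integrableOn_Ioo,
        intervalIntegral.integrableOn_Ioo_rpow_iff one_pos]
      linarith
    refine h_dom.mono' hm.aestronglyMeasurable ?_
    filter_upwards [ae_restrict_mem measurableSet_Ioc] with y hy
    have hy0 : 0 ≤ y ^ (s - 2) := Real.rpow_nonneg hy.1.le _
    have h_le_one : (1 + y ^ 2) ^ (-s / 2) ≤ 1 :=
      Real.rpow_le_one_of_one_le_of_nonpos (by nlinarith [sq_nonneg y]) (by linarith)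
    rw [Real.norm_of_nonneg (by positivity)]
    exact mul_le_of_le_one_right hy0 h_le_one
  · have h_dom : IntegrableOn (fun y : ℝ => y ^ (-2 : ℝ)) (Set.Ioi 1) :=
      integrableOn_Ioi_rpow_of_lt (by norm_num) one_pos
    refine h_dom.mono' hm.aestronglyMeasurable ?_
    filter_upwards [ae_restrict_mem measurableSet_Ioi] with y hy
    have hy0 : 0 < y := one_pos.trans hy
    have h_le_rpow : (1 + y ^ 2) ^ (-s / 2) ≤ y ^ (-s) := by
      calc (1 + y ^ 2) ^ (-s / 2) ≤ (y ^ 2) ^ (-s / 2) :=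
            Real.rpow_le_rpow_of_nonpos (by positivity) (by linarith) (by linarith)
        _ = y ^ (-s) := by
            rw [← Real.rpow_natCast, ← Real.rpow_mul hy0.le]
            congr 1
            push_cast
            ring
    rw [Real.norm_of_nonneg (by positivity)]
    calc y ^ (s - 2) * (1 + y ^ 2) ^ (-s / 2) ≤ y ^ (s - 2) * y ^ (-s) := by gcongr
      _ = y ^ (-2 : ℝ) := by rw [← Real.rpow_add hy0]; ring_nf

theorem one_add_sq_add_sq_rpow_neg_le {s : ℝ} (hs : 0 ≤ s) (x y : ℝ) :
    (1 + x ^ 2 + y ^ 2) ^ (-s) ≤ (1 + x ^ 2) ^ (-s / 2) * (1 + y ^ 2) ^ (-s / 2) := by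
  have hx := sq_nonneg x
  have hy := sq_nonneg y
  calc (1 + x ^ 2 + y ^ 2) ^ (-s)
      = (1 + x ^ 2 + y ^ 2) ^ (-s / 2) * (1 + x ^ 2 + y ^ 2) ^ (-s / 2) := by
        rw [← Real.rpow_add (by positivity)]
        ring_nf
    _ ≤ _ := mul_le_mul
        (Real.rpow_le_rpow_of_nonpos (by positivity) (by linarith) (by linarith))
        (Real.rpow_le_rpow_of_nonpos (by positivity) (by linarith) (by linarith))
        (by positivity) (by positivity)

theorem cosh_dist_I (v : ℍ) : Real.cosh (dist UpperHalfPlane.I v) =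
    (1 + v.re ^ 2 + v.im ^ 2) / (2 * v.im) := by
  rw [UpperHalfPlane.cosh_dist']
  simp only [UpperHalfPlane.I_re, UpperHalfPlane.I_im]
  ring

theorem cosh_dist_I_rpow_neg_le {s : ℝ} (hs : 0 ≤ s) (v : ℍ) :
    Real.cosh (dist UpperHalfPlane.I v) ^ (-s) ≤
      (2 ^ s * (1 + v.re ^ 2) ^ (-s / 2)) * (v.im ^ s * (1 + v.im ^ 2) ^ (-s / 2)) := by
  have hy := v.im_pos
  calc Real.cosh (dist UpperHalfPlane.I v) ^ (-s)
      = 2 ^ s * v.im ^ s * (1 + v.re ^ 2 + v.im ^ 2) ^ (-s) := by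
        rw [cosh_dist_I, Real.div_rpow (by positivity) (by positivity),
          Real.mul_rpow (by norm_num) hy.le, Real.rpow_neg zero_le_two, Real.rpow_neg hy.le]
        field_simp
    _ ≤ 2 ^ s * v.im ^ s * ((1 + v.re ^ 2) ^ (-s / 2) * (1 + v.im ^ 2) ^ (-s / 2)) := by
        gcongr
        exact one_add_sq_add_sq_rpow_neg_le hs _ _
    _ = _ := by ring

theorem lintegral_cosh_dist_I_rpow_lt_top {s : ℝ} (hs : 1 < s) :
    ∫⁻ v : ℍ, ENNReal.ofReal (Real.cosh (dist UpperHalfPlane.I v) ^ (-s)) < ⊤ := by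
  have hx : Integrable fun x : ℝ => 2 ^ s * (1 + x ^ 2) ^ (-s / 2) := by
    have := integrable_rpow_neg_one_add_norm_sq (E := ℝ) (μ := volume) (r := s) (by simpa)
    simpa only [Real.norm_eq_abs, sq_abs] using this.const_mul (2 ^ s)
  have hy : ∫⁻ y in Set.Ioi (0 : ℝ), ENNReal.ofReal ((1 / y) ^ 2) *
      ENNReal.ofReal (y ^ s * (1 + y ^ 2) ^ (-s / 2)) < ⊤ := by
    refine lt_of_eq_of_lt (setLIntegral_congr_fun measurableSet_Ioi fun y hy => ?_)
      (integrableOn_rpow_mul_one_add_sq_rpow hs).lintegral_lt_top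
    have hy0 : (0 : ℝ) < y := hy
    rw [← ENNReal.ofReal_mul (by positivity), Real.rpow_sub hy0, Real.rpow_two]
    ring_nf
  calc ∫⁻ v : ℍ, ENNReal.ofReal (Real.cosh (dist UpperHalfPlane.I v) ^ (-s))
      ≤ ∫⁻ v : ℍ, ENNReal.ofReal (2 ^ s * (1 + v.re ^ 2) ^ (-s / 2)) *
          ENNReal.ofReal (v.im ^ s * (1 + v.im ^ 2) ^ (-s / 2)) := by
        refine lintegral_mono fun v => ?_
        rw [← ENNReal.ofReal_mul (by positivity)]
        exact ENNReal.ofReal_le_ofReal (cosh_dist_I_rpow_neg_le (one_pos.trans hs).le v)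
    _ = _ := lintegral_re_mul_im (f := fun x => ENNReal.ofReal (2 ^ s * (1 + x ^ 2) ^ (-s / 2)))
        (g := fun y => ENNReal.ofReal (y ^ s * (1 + y ^ 2) ^ (-s / 2))) (by fun_prop) (by fun_prop)
    _ < ⊤ := ENNReal.mul_lt_top hx.lintegral_lt_top hy

theorem exists_summable_smul_of_isFundamentalDomain {G α : Type*} [Group G] [Countable G]
    [MulAction G α] [MeasurableSpace α] {μ : Measure α} [NeZero μ] [MeasurableConstSMul G α]
    [SMulInvariantMeasure G α μ] {F : Set α} (hF : IsFundamentalDomain G F μ) {f : α → ℝ}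
    (hf : Measurable f) (hf0 : ∀ x, 0 ≤ f x) (hint : ∫⁻ x, ENNReal.ofReal (f x) ∂μ < ⊤) :
    ∃ x, Summable fun g : G => f (g • x) := by
  have hmeas (g : G) : Measurable fun x => ENNReal.ofReal (f (g • x)) :=
    (hf.comp (measurable_const_smul g)).ennreal_ofReal
  have hfin : ∫⁻ x in F, ∑' g : G, ENNReal.ofReal (f (g • x)) ∂μ < ⊤ := by
    rw [lintegral_tsum fun g => (hmeas g).aemeasurable]
    rwa [hF.lintegral_eq_tsum''] at hint
  have : (ae (μ.restrict F)).NeBot := by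
    rw [ae_neBot, Ne, Measure.restrict_eq_zero]
    exact hF.measure_ne_zero (NeZero.ne μ)
  obtain ⟨x, hx⟩ := (ae_lt_top (Measurable.tsum hmeas) hfin.ne).exists
  exact ⟨x, (ENNReal.summable_toReal hx.ne).congr fun g => ENNReal.toReal_ofReal (hf0 _)⟩

theorem cosh_le_exp_mul_cosh {p q D : ℝ} (hp : 0 ≤ p) (hD : 0 ≤ D) (h : p ≤ q + D) :
    Real.cosh p ≤ Real.exp D * Real.cosh q := by
  have h_mono : Real.cosh p ≤ Real.cosh (q + D) := by
    rw [Real.cosh_le_cosh, abs_of_nonneg hp]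
    exact h.trans (le_abs_self _)
  refine h_mono.trans ?_
  rw [Real.cosh_add, ← Real.cosh_add_sinh D, mul_comm, add_mul]
  have : Real.sinh q ≤ Real.cosh q := (Real.sinh_lt_cosh q).le
  have h_sinh_nonneg : 0 ≤ Real.sinh D := Real.sinh_nonneg_iff.2 hD
  nlinarith

theorem summable_cosh_dist_rpow_neg_of_summable {G X : Type*} [Group G] [PseudoMetricSpace X]
    [MulAction G X] [IsIsometricSMul G X] {s : ℝ} (hs : 0 ≤ s) {x y : X}
    (h : Summable fun g : G => Real.cosh (dist x (g • y)) ^ (-s)) (z w : X) :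
    Summable fun g : G => Real.cosh (dist z (g • w)) ^ (-s) := by
  set D := dist x z + dist w y
  refine (h.mul_left (Real.exp D ^ s)).of_nonneg_of_le (fun g => by positivity) fun g => ?_
  have hdist : dist x (g • y) ≤ dist z (g • w) + D := by
    have := dist_triangle4 x z (g • w) (g • y)
    rw [dist_smul] at this
    linarith
  have hcosh := cosh_le_exp_mul_cosh dist_nonneg (by positivity) hdist
  have hrpow : (Real.exp D * Real.cosh (dist z (g • w))) ^ (-s) ≤
      Real.cosh (dist x (g • y)) ^ (-s) :=
    Real.rpow_le_rpow_of_nonpos (Real.cosh_pos _) hcosh (by linarith)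
  rwa [Real.mul_rpow (Real.exp_pos _).le (Real.cosh_pos _).le, Real.rpow_neg (Real.exp_pos _).le,
    inv_mul_le_iff₀ (by positivity)] at hrpow

theorem summable_cosh_dist_rpow_neg {G : Type*} [Group G] [Countable G] [MulAction G ℍ]
    [IsIsometricSMul G ℍ] [SMulInvariantMeasure G ℍ volume] {F : Set ℍ}
    (hF : IsFundamentalDomain G F) {s : ℝ} (hs : 1 < s) (z w : ℍ) :
    Summable fun g : G => Real.cosh (dist z (g • w)) ^ (-s) := by
  have : NeZero (volume : Measure ℍ) := ⟨Measure.measure_univ_ne_zero.1 volume_univ_pos.ne'⟩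
  have : MeasurableConstSMul G ℍ := ⟨fun g => (isometry_smul ℍ g).continuous.measurable⟩
  obtain ⟨v, hv⟩ := exists_summable_smul_of_isFundamentalDomain hF
    (f := fun v => Real.cosh (dist UpperHalfPlane.I v) ^ (-s)) (by fun_prop)
    (fun v => by positivity) (lintegral_cosh_dist_I_rpow_lt_top hs)
  exact summable_cosh_dist_rpow_neg_of_summable (one_pos.trans hs).le hv z w

/-! ### Gamma quotients and the binomial series -/

theorem re_add_natCast_pos {c : ℂ} (hc : 0 < c.re) (n : ℕ) : 0 < (c + n).re := by
  rw [Complex.add_re, Complex.natCast_re]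
  positivity

theorem norm_add_half_sq_le {ν : ℂ} (hν : 0 < ν.re) :
    ‖ν + 1 / 2‖ ^ 2 ≤ Real.exp (1 / 4 * (1 / ν.re - 1 / (ν.re + 1))) * (‖ν‖ * ‖ν + 1‖) := by
  set q := ν.re * (ν.re + 1)
  set P := ‖ν‖ * ‖ν + 1‖
  have hq : 0 < q := by positivity
  have hqP : q ≤ P := by
    have h := Complex.re_le_norm (ν + 1)
    rw [Complex.add_re, Complex.one_re] at h
    exact mul_le_mul (Complex.re_le_norm ν) h (by positivity) (norm_nonneg _)
  have hexp : 1 / 4 * (1 / ν.re - 1 / (ν.re + 1)) = 1 / 4 / q := by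
    simp only [q]
    field_simp
    ring
  calc ‖ν + 1 / 2‖ ^ 2 = ‖ν * (ν + 1) + 1 / 4‖ := by
        rw [← norm_pow]
        ring_nf
    _ ≤ P + 1 / 4 := by
        refine (norm_add_le _ _).trans ?_
        rw [norm_mul]
        norm_num [P]
    _ ≤ (1 / 4 / q + 1) * P := by
        have : 1 / 4 ≤ 1 / 4 / q * P := by
          rw [div_mul_eq_mul_div, le_div_iff₀ hq]
          gcongr
        linarith
    _ ≤ Real.exp (1 / 4 / q) * P := by
        gcongr
        exact Real.add_one_le_exp _
    _ = _ := by rw [hexp]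

theorem prod_norm_add_half_sq_le {ν : ℂ} (hν : 0 < ν.re) (n : ℕ) :
    ∏ j ∈ Finset.range n, ‖ν + 1 / 2 + j‖ ^ 2 ≤
      Real.exp (1 / 4 * (1 / ν.re - 1 / (ν.re + n))) *
        ∏ j ∈ Finset.range n, (‖ν + j‖ * ‖ν + 1 + j‖) := by
  induction n with
  | zero => simp
  | succ n ih =>
    have hfactor := norm_add_half_sq_le (re_add_natCast_pos hν n)
    simp only [Complex.add_re, Complex.natCast_re, add_right_comm ν (n : ℂ)] at hfactor
    rw [Finset.prod_range_succ, Finset.prod_range_succ]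
    calc _ ≤ (Real.exp (1 / 4 * (1 / ν.re - 1 / (ν.re + n))) *
          ∏ j ∈ Finset.range n, (‖ν + j‖ * ‖ν + 1 + j‖)) *
          (Real.exp (1 / 4 * (1 / (ν.re + n) - 1 / (ν.re + n + 1))) *
          (‖ν + n‖ * ‖ν + 1 + n‖)) := by gcongr
      _ = _ := by
        rw [mul_mul_mul_comm, ← Real.exp_add]
        push_cast
        ring_nf

theorem norm_GammaSeq_mul_norm_GammaSeq_add_one_le {ν : ℂ} (hν : 0 < ν.re) {n : ℕ} (hn : n ≠ 0) :
    ‖Complex.GammaSeq ν n‖ * ‖Complex.GammaSeq (ν + 1) n‖ ≤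
      Real.exp (1 / (4 * ν.re)) * ‖Complex.GammaSeq (ν + 1 / 2) n‖ ^ 2 := by
  have hprod_pos (c : ℂ) (hc : 0 < c.re) : 0 < ∏ j ∈ Finset.range (n + 1), ‖c + j‖ :=
    Finset.prod_pos fun j _ => norm_pos_iff.2 fun h =>
      (re_add_natCast_pos hc j).ne' (by rw [h, Complex.zero_re])
  have hA := hprod_pos ν hν
  have hB := hprod_pos (ν + 1) (by rw [Complex.add_re, Complex.one_re]; linarith)
  have hC := hprod_pos (ν + 1 / 2) (by norm_num; linarith)
  have hpow : ‖(n : ℂ) ^ ν‖ * ‖(n : ℂ) ^ (ν + 1)‖ = ‖(n : ℂ) ^ (ν + 1 / 2)‖ ^ 2 := by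
    have hn0 : (n : ℂ) ≠ 0 := Nat.cast_ne_zero.2 hn
    rw [← norm_mul, ← norm_pow, ← Complex.cpow_add _ _ hn0, sq, ← Complex.cpow_add _ _ hn0]
    ring_nf
  have hprod := prod_norm_add_half_sq_le hν (n + 1)
  rw [Finset.prod_mul_distrib, Finset.prod_pow] at hprod
  simp only [Complex.GammaSeq, norm_div, norm_mul, norm_prod]
  rw [div_mul_div_comm, div_pow, ← mul_div_assoc, div_le_div_iff₀ (by positivity) (by positivity),
    mul_mul_mul_comm, hpow, mul_pow]
  set A := ∏ j ∈ Finset.range (n + 1), ‖ν + j‖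
  set B := ∏ j ∈ Finset.range (n + 1), ‖ν + 1 + j‖
  set C := ∏ j ∈ Finset.range (n + 1), ‖ν + 1 / 2 + j‖
  have hCAB : C ^ 2 ≤ Real.exp (1 / (4 * ν.re)) * (A * B) := by
    refine hprod.trans ?_
    gcongr
    have : 0 ≤ 1 / (ν.re + (n + 1 : ℕ)) := by positivity
    rw [← one_div_mul_one_div]
    linarith
  calc _ ≤ ‖(n : ℂ) ^ (ν + 1 / 2)‖ ^ 2 * (‖(n.factorial : ℂ)‖ * ‖(n.factorial : ℂ)‖) *
        (Real.exp (1 / (4 * ν.re)) * (A * B)) := by gcongr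
    _ = _ := by ring

theorem norm_Gamma_div_Gamma_add_half_sq_le {ν : ℂ} (hν : 0 < ν.re) :
    ‖Complex.Gamma ν / Complex.Gamma (ν + 1 / 2)‖ ^ 2 ≤
      Real.exp (1 / (4 * ν.re)) / ‖ν‖ := by
  have hν0 : ν ≠ 0 := by
    rintro rfl
    exact hν.ne' Complex.zero_re
  have hGamma : Complex.Gamma (ν + 1 / 2) ≠ 0 :=
    Complex.Gamma_ne_zero_of_re_pos (by norm_num; linarith)
  have hlim := le_of_tendsto_of_tendsto
    ((Complex.GammaSeq_tendsto_Gamma ν).norm.mul (Complex.GammaSeq_tendsto_Gamma (ν + 1)).norm)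
    (((Complex.GammaSeq_tendsto_Gamma (ν + 1 / 2)).norm.pow 2).const_mul _)
    ((eventually_ne_atTop 0).mono fun n hn => norm_GammaSeq_mul_norm_GammaSeq_add_one_le hν hn)
  rw [Complex.Gamma_add_one _ hν0, norm_mul] at hlim
  rw [norm_div, div_pow, div_le_div_iff₀ (pow_pos (norm_pos_iff.2 hGamma) 2) (norm_pos_iff.2 hν0)]
  linarith

theorem choose_add_sub_one_eq_poch (a : ℂ) (n : ℕ) :
    Ring.choose (a + n - 1) n = poch a n / n.factorial := by
  have := Ring.factorial_nsmul_multichoose_eq_ascPochhammer a n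
  rw [Ring.multichoose_eq, Polynomial.ascPochhammer_smeval_eq_eval, nsmul_eq_mul] at this
  rw [poch, ← this, mul_div_cancel_left₀]
  exact_mod_cast n.factorial_ne_zero

theorem summable_norm_poch_div_factorial (a : ℂ) {r : ℝ} (h0 : 0 ≤ r) (hr : r < 1) :
    Summable fun n : ℕ => ‖poch a n / n.factorial‖ * r ^ n := by
  have h := Complex.one_div_one_sub_cpow_hasFPowerSeriesOnBall_zero a
  lift r to NNReal using h0
  have h_series := FormalMultilinearSeries.summable_norm_mul_pow (r := r) _
    (lt_of_lt_of_le (by exact_mod_cast hr) h.r_le)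
  simpa [choose_add_sub_one_eq_poch] using h_series

theorem hasSum_poch_div_factorial (a : ℂ) {z : ℂ} (hz : ‖z‖ < 1) :
    HasSum (fun n : ℕ => poch a n / n.factorial * z ^ n) ((1 - z) ^ (-a)) := by
  have h := Complex.one_div_one_sub_cpow_hasFPowerSeriesOnBall_zero a
  have h_series := h.hasSum (y := z) (by simpa [enorm_eq_nnnorm] using! hz)
  simpa [choose_add_sub_one_eq_poch, Complex.cpow_neg, mul_comm] using h_series

/-! ### The Legendre function of the second kind -/

theorem hasSum_integral_mul {α : Type*} [MeasurableSpace α] {m : Measure α} {f : α → ℂ}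
    (hf : Integrable f m) {ι : Type*} [Countable ι] {g : ι → α → ℂ}
    (hg : ∀ k, AEStronglyMeasurable (g k) m)
    {B : ι → ℝ} (hB : Summable B) (hgB : ∀ k, ∀ᵐ s ∂m, ‖g k s‖ ≤ B k) {G : α → ℂ}
    (hG : ∀ᵐ s ∂m, HasSum (fun k => g k s) (G s)) :
    HasSum (fun k => ∫ s, f s * g k s ∂m) (∫ s, f s * G s ∂m) := by
  refine hasSum_integral_of_dominated_convergence (fun k s => ‖f s‖ * B k)
    (fun k => hf.aestronglyMeasurable.mul (hg k)) (fun k => ?_)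
    (Filter.Eventually.of_forall fun s => hB.mul_left _) ?_ ?_
  · filter_upwards [hgB k] with s hs
    rw [norm_mul]
    gcongr
  · simp_rw [tsum_mul_left]
    exact hf.norm.mul_const _
  · filter_upwards [hG] with s hs
    exact hs.mul_left _

/-- The Legendre function of the second kind `Q_{μ-1}((a + a⁻¹) / 2)`, for `0 < a < 1` and
`0 < Re μ`. With `a = e^{-d}` the argument is `cosh d`. -/
def legendreQ (a : ℝ) (μ : ℂ) : ℂ :=
  ∫ w in Set.Ioo 0 a, (w : ℂ) ^ (μ - 1) / (√((a - w) * (a⁻¹ - w)) : ℂ)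

/-- The `k`-th term of the expansion of `legendreQ a μ` in powers of `a`, obtained by integrating
the binomial series of `(1 - a w)^{-1/2}` term by term. -/
def legendreQTerm (a : ℝ) (μ : ℂ) (k : ℕ) : ℂ :=
  (a : ℂ) ^ μ * (poch (1 / 2) k / k.factorial * (a : ℂ) ^ (2 * k) *
    Complex.betaIntegral (μ + k) (1 / 2))

theorem cpow_one_half_sub_one {r : ℝ} (hr : 0 ≤ r) :
    (r : ℂ) ^ (1 / 2 - 1 : ℂ) = (√r : ℂ)⁻¹ := by
  have hexponent : (1 / 2 - 1 : ℂ) = ((-(1 / 2) : ℝ) : ℂ) := by push_cast; ring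
  rw [hexponent, ← Complex.ofReal_cpow hr, Real.rpow_neg hr, Real.sqrt_eq_rpow, Complex.ofReal_inv]

theorem cpow_neg_one_half {r : ℝ} (hr : 0 ≤ r) :
    (r : ℂ) ^ (-(1 / 2) : ℂ) = (√r : ℂ)⁻¹ := by
  rw [← cpow_one_half_sub_one hr]
  norm_num

theorem legendreQ_eq_integral {a : ℝ} (h0 : 0 < a) (h1 : a < 1) (μ : ℂ) :
    legendreQ a μ = (a : ℂ) ^ μ * ∫ s in (0 : ℝ)..1,
      ((s : ℂ) ^ (μ - 1) * (1 - (s : ℂ)) ^ (1 / 2 - 1 : ℂ)) *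
        (1 - ((a ^ 2 * s : ℝ) : ℂ)) ^ (-(1 / 2) : ℂ) := by
  have ha0 : (a : ℂ) ≠ 0 := Complex.ofReal_ne_zero.2 h0.ne'
  have hscale := intervalIntegral.integral_comp_mul_left (a := 0) (b := 1)
    (fun w : ℝ => (w : ℂ) ^ (μ - 1) / (√((a - w) * (a⁻¹ - w)) : ℂ)) h0.ne'
  rw [mul_zero, mul_one, eq_inv_smul_iff₀ h0.ne'] at hscale
  have hpow : (a : ℂ) ^ μ = a * (a : ℂ) ^ (μ - 1) := by
    rw [Complex.cpow_sub _ _ ha0, Complex.cpow_one, mul_div_cancel₀ _ ha0]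
  rw [legendreQ, ← integral_Ioc_eq_integral_Ioo, ← intervalIntegral.integral_of_le h0.le,
    ← hscale, Complex.real_smul, hpow, mul_assoc]
  congr 1
  rw [← intervalIntegral.integral_const_mul]
  refine intervalIntegral.integral_congr fun s hs => ?_
  rw [Set.uIcc_of_le zero_le_one] at hs
  have hs1 : 0 ≤ 1 - s := by linarith [hs.2]
  have has : 0 ≤ 1 - a ^ 2 * s := by nlinarith [hs.1, hs.2]
  have hfactor : (a - a * s) * (a⁻¹ - a * s) = (1 - s) * (1 - a ^ 2 * s) := by field_simp
  rw [hfactor, ← Complex.ofReal_one, ← Complex.ofReal_sub, ← Complex.ofReal_sub, Complex.ofReal_one,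
    cpow_one_half_sub_one hs1, cpow_neg_one_half has, Real.sqrt_mul hs1,
    Complex.ofReal_mul a s, Complex.mul_cpow_ofReal_nonneg h0.le hs.1, Complex.ofReal_mul]
  field_simp

theorem hasSum_legendreQTerm {a : ℝ} (h0 : 0 < a) (h1 : a < 1) {μ : ℂ} (hμ : 0 < μ.re) :
    HasSum (legendreQTerm a μ) (legendreQ a μ) := by
  have ha2 : a ^ 2 < 1 := by nlinarith
  have hbeta := Complex.betaIntegral_convergent (u := μ) (v := 1 / 2) hμ (by norm_num)
  rw [intervalIntegrable_iff_integrableOn_Ioc_of_le zero_le_one] at hbeta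
  have hnorm {s : ℝ} (hs : s ∈ Set.Ioc (0 : ℝ) 1) : ‖((a ^ 2 * s : ℝ) : ℂ)‖ ≤ a ^ 2 := by
    rw [Complex.norm_real, Real.norm_of_nonneg (mul_nonneg (sq_nonneg a) hs.1.le)]
    exact mul_le_of_le_one_right (by positivity) hs.2
  have hsum := hasSum_integral_mul hbeta
    (g := fun k s => poch (1 / 2) k / k.factorial * ((a ^ 2 * s : ℝ) : ℂ) ^ k)
    (B := fun k => ‖poch (1 / 2) k / k.factorial‖ * (a ^ 2) ^ k)
    (G := fun s => (1 - ((a ^ 2 * s : ℝ) : ℂ)) ^ (-(1 / 2) : ℂ))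
    (fun k => Continuous.aestronglyMeasurable (by fun_prop))
    (summable_norm_poch_div_factorial _ (by positivity) ha2)
    (fun k => by
      filter_upwards [ae_restrict_mem measurableSet_Ioc] with s hs
      rw [norm_mul, norm_pow]
      gcongr
      exact hnorm hs)
    (by
      filter_upwards [ae_restrict_mem measurableSet_Ioc] with s hs
      exact hasSum_poch_div_factorial _ ((hnorm hs).trans_lt ha2))
  rw [legendreQ_eq_integral h0 h1, intervalIntegral.integral_of_le zero_le_one]
  convert! hsum.mul_left ((a : ℂ) ^ μ) using 1
  funext k
  rw [legendreQTerm, Complex.betaIntegral, intervalIntegral.integral_of_le zero_le_one,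
    ← integral_const_mul]
  congr 1
  refine setIntegral_congr_fun measurableSet_Ioc fun s hs => ?_
  have hs0 : (s : ℂ) ≠ 0 := Complex.ofReal_ne_zero.2 hs.1.ne'
  simp only [add_sub_right_comm, Complex.cpow_add _ _ hs0, Complex.cpow_natCast]
  push_cast
  ring

theorem betaIntegral_one_half {μ : ℂ} (hμ : 0 < μ.re) :
    Complex.betaIntegral μ (1 / 2) =
      Complex.Gamma μ / Complex.Gamma (μ + 1 / 2) * Complex.Gamma (1 / 2) := by
  rw [Complex.betaIntegral_eq_Gamma_mul_div _ _ hμ (by norm_num), mul_div_right_comm]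

theorem norm_betaIntegral_one_half_le {σ : ℝ} (hσ : 0 < σ) {μ : ℂ} (hμ : σ ≤ μ.re) (k : ℕ) :
    ‖Complex.betaIntegral (μ + k) (1 / 2)‖ ≤
      √(Real.exp (1 / (4 * σ))) * ‖Complex.Gamma (1 / 2)‖ / √‖μ‖ := by
  have hk : (0 : ℝ) ≤ k := k.cast_nonneg
  have hre : σ ≤ (μ + k).re := by
    rw [Complex.add_re, Complex.natCast_re]
    linarith
  have hμ0 : 0 < ‖μ‖ := (hσ.trans_le hμ).trans_le (Complex.re_le_norm μ)
  have hle : ‖μ‖ ≤ ‖μ + k‖ := by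
    rw [← sq_le_sq₀ (norm_nonneg _) (norm_nonneg _), Complex.sq_norm, Complex.sq_norm,
      Complex.normSq_apply, Complex.normSq_apply]
    simp only [Complex.add_re, Complex.add_im, Complex.natCast_re, Complex.natCast_im, add_zero]
    nlinarith [hk]
  have hquotient : ‖Complex.Gamma (μ + k) / Complex.Gamma (μ + k + 1 / 2)‖ ^ 2 ≤
      Real.exp (1 / (4 * σ)) / ‖μ‖ := by
    refine (norm_Gamma_div_Gamma_add_half_sq_le (hσ.trans_le hre)).trans ?_
    gcongr
  rw [betaIntegral_one_half (hσ.trans_le hre), norm_mul, mul_div_right_comm,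
    ← Real.sqrt_div (Real.exp_pos _).le]
  gcongr
  exact Real.le_sqrt_of_sq_le hquotient

theorem norm_legendreQTerm_le {σ : ℝ} (hσ : 0 < σ) {a : ℝ} (h0 : 0 < a)
    {μ : ℂ} (hμ : σ ≤ μ.re) (k : ℕ) :
    ‖legendreQTerm a μ k‖ ≤ √(Real.exp (1 / (4 * σ))) * ‖Complex.Gamma (1 / 2)‖ / √‖μ‖ *
      a ^ μ.re * (‖poch (1 / 2) k / k.factorial‖ * (a ^ 2) ^ k) := by
  rw [legendreQTerm, norm_mul, norm_mul, norm_mul, Complex.norm_cpow_eq_rpow_re_of_pos h0,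
    norm_pow, Complex.norm_real, Real.norm_of_nonneg h0.le, pow_mul]
  have := norm_betaIntegral_one_half_le hσ hμ k
  calc _ ≤ a ^ μ.re * (‖poch (1 / 2) k / k.factorial‖ * (a ^ 2) ^ k *
        (√(Real.exp (1 / (4 * σ))) * ‖Complex.Gamma (1 / 2)‖ / √‖μ‖)) := by gcongr
    _ = _ := by ring

theorem exists_norm_legendreQ_le {σ : ℝ} (hσ : 0 < σ) {a₀ : ℝ} (h1 : a₀ < 1) :
    ∃ C, 0 ≤ C ∧ ∀ a, 0 < a → a ≤ a₀ → ∀ μ : ℂ, σ ≤ μ.re →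
      ‖legendreQ a μ‖ ≤ C * a ^ μ.re / √‖μ‖ := by
  by_cases ha₀ : 0 < a₀
  swap
  · exact ⟨0, le_rfl, fun a h h' => absurd (h.trans_le h') ha₀⟩
  have hS := summable_norm_poch_div_factorial (1 / 2) (r := a₀ ^ 2) (by positivity) (by nlinarith)
  refine ⟨√(Real.exp (1 / (4 * σ))) * ‖Complex.Gamma (1 / 2)‖ *
    ∑' k : ℕ, ‖poch (1 / 2) k / k.factorial‖ * (a₀ ^ 2) ^ k, by positivity,
    fun a h0 ha μ hμ => ?_⟩
  rw [← (hasSum_legendreQTerm h0 (ha.trans_lt h1) (hσ.trans_le hμ)).tsum_eq]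
  refine (tsum_of_norm_bounded (hS.hasSum.mul_left (√(Real.exp (1 / (4 * σ))) *
    ‖Complex.Gamma (1 / 2)‖ / √‖μ‖ * a ^ μ.re)) fun k => ?_).trans_eq ?_
  · refine (norm_legendreQTerm_le hσ h0 hμ k).trans ?_
    gcongr
  · ring

theorem integrableOn_inv_sqrt_sub_mul_sub {a c : ℝ} (h0 : 0 ≤ a) (hac : a < c) :
    IntegrableOn (fun w : ℝ => (√((a - w) * (c - w)))⁻¹) (Set.Ioo 0 a) := by
  have hsingle : IntegrableOn (fun w : ℝ => (√(c - a))⁻¹ * (a - w) ^ (-(1 / 2) : ℝ))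
      (Set.Ioo 0 a) := by
    have h := (intervalIntegral.intervalIntegrable_rpow' (a := a) (b := 0)
      (r := -(1 / 2)) (by norm_num)).comp_sub_left a
    rw [sub_self, sub_zero, intervalIntegrable_iff_integrableOn_Ioo_of_le h0] at h
    exact h.const_mul _
  refine hsingle.mono' (by fun_prop) ?_
  filter_upwards [ae_restrict_mem measurableSet_Ioo] with w hw
  have hwa : 0 < a - w := sub_pos.2 hw.2
  rw [Real.norm_of_nonneg (by positivity), Real.sqrt_mul hwa.le, mul_inv, mul_comm,
    Real.rpow_neg hwa.le, ← Real.sqrt_eq_rpow]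
  gcongr
  linarith [hw.2]

theorem differentiableAt_legendreQ {a : ℝ} (h0 : 0 < a) (h1 : a < 1) {μ : ℂ} (hμ : 0 < μ.re) :
    DifferentiableAt ℂ (legendreQ a) μ := by
  set f : ℝ → ℂ := (Set.Ioo 0 a).indicator fun w => (((√((a - w) * (a⁻¹ - w)))⁻¹ : ℝ) : ℂ)
  have hmellin : legendreQ a = mellin f := by
    funext ν
    have hindicator (w : ℝ) : (w : ℂ) ^ (ν - 1) • f w = (Set.Ioo 0 a).indicator
        (fun w : ℝ => (w : ℂ) ^ (ν - 1) / (√((a - w) * (a⁻¹ - w)) : ℂ)) w := by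
      by_cases hw : w ∈ Set.Ioo 0 a <;> simp [f, hw, div_eq_mul_inv]
    simp only [mellin, hindicator]
    rw [setIntegral_indicator measurableSet_Ioo,
      Set.inter_eq_right.2 Set.Ioo_subset_Ioi_self, legendreQ]
  have hint : Integrable f := by
    have := integrableOn_inv_sqrt_sub_mul_sub h0.le (h1.trans (one_lt_inv₀ h0 |>.2 h1))
    exact (integrable_indicator_iff measurableSet_Ioo).2 this.ofReal
  have htop : f =O[atTop] (· ^ (-(μ.re + 1)) : ℝ → ℝ) := by
    refine Asymptotics.IsBigO.of_bound 0 ?_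
    filter_upwards [eventually_ge_atTop a] with w hw
    rw [show f w = 0 from Set.indicator_of_notMem (fun h => hw.not_gt h.2) _, norm_zero, zero_mul]
  have hbot : f =O[𝓝[>] 0] (· ^ (-(0 : ℝ)) : ℝ → ℝ) := by
    have hcont : ContinuousAt (fun w : ℝ => (((√((a - w) * (a⁻¹ - w)))⁻¹ : ℝ) : ℂ)) 0 := by
      refine Complex.continuous_ofReal.continuousAt.comp (ContinuousAt.inv₀ (by fun_prop) ?_)
      simp [h0.ne']
    simp only [neg_zero, Real.rpow_zero]
    refine ((hcont.tendsto.isBigO_one ℝ).mono nhdsWithin_le_nhds).congr' ?_ EventuallyEq.rfl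
    filter_upwards [Ioo_mem_nhdsGT h0] with w hw
    simp only [f, Set.indicator_of_mem hw]
  rw [hmellin]
  exact mellin_differentiableAt_of_isBigO_rpow (hint.locallyIntegrable.locallyIntegrableOn _)
    htop (by linarith) hbot hμ

/-! ### The quadratic transformation -/

/-- The Joukowski map `a ↦ (a + a⁻¹) / 2`, which sends `e^{-d}` to `cosh d`. -/
def joukowski (a : ℝ) : ℝ := (a + a⁻¹) / 2

theorem one_lt_joukowski {a : ℝ} (h0 : 0 < a) (h1 : a < 1) : 1 < joukowski a := by
  rw [joukowski, lt_div_iff₀ two_pos]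
  have hmul : a * a⁻¹ = 1 := mul_inv_cancel₀ h0.ne'
  have hinv : 1 < a⁻¹ := (one_lt_inv₀ h0).2 h1
  nlinarith [hinv]

theorem antitoneOn_joukowski : AntitoneOn joukowski (Set.Ioc 0 1) := by
  intro a ha c hc hac
  have ha0 := ha.1
  have hc0 := hc.1
  have hsub : joukowski a - joukowski c = (c - a) * (1 - a * c) / (2 * (a * c)) := by
    rw [joukowski, joukowski]
    field_simp
    ring
  have hnonneg : 0 ≤ (c - a) * (1 - a * c) / (2 * (a * c)) :=
    div_nonneg (mul_nonneg (by linarith) (by nlinarith [ha.2, hc.2])) (by positivity)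
  linarith

/-- The substitution `t ↦ (1 - t²) / (2 (x - t))` for `x = (a + a⁻¹) / 2`: it maps each of
`(-1, a)` and `(a, 1)` bijectively onto `(0, a)`, the range of integration of `legendreQ a`. -/
def quadSubst (a t : ℝ) : ℝ := (1 - t ^ 2) / (2 * (joukowski a - t))

section quadSubst

variable {a t : ℝ}

theorem sub_quadSubst (h0 : 0 < a) (hx : t < joukowski a) :
    a - quadSubst a t = (t - a) ^ 2 / (2 * (joukowski a - t)) := by
  have : joukowski a - t ≠ 0 := by linarith
  rw [quadSubst, eq_div_iff (by positivity), sub_mul, div_mul_cancel₀ _ (by positivity), joukowski]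
  field_simp
  ring

theorem inv_sub_quadSubst (h0 : 0 < a) (hx : t < joukowski a) :
    a⁻¹ - quadSubst a t = (t - a⁻¹) ^ 2 / (2 * (joukowski a - t)) := by
  have : joukowski a - t ≠ 0 := by linarith
  rw [quadSubst, eq_div_iff (by positivity), sub_mul, div_mul_cancel₀ _ (by positivity), joukowski]
  field_simp
  ring

theorem sqrt_quadSubst (h0 : 0 < a) (hx : t < joukowski a) :
    √((a - quadSubst a t) * (a⁻¹ - quadSubst a t)) =
      |(t - a) * (t - a⁻¹)| / (2 * (joukowski a - t)) := by
  have : 0 < joukowski a - t := by linarith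
  rw [sub_quadSubst h0 hx, inv_sub_quadSubst h0 hx, div_mul_div_comm, ← mul_pow, ← sq,
    Real.sqrt_div (sq_nonneg _), Real.sqrt_sq_eq_abs, Real.sqrt_sq (by positivity)]

theorem quadSubst_sub_self (h0 : 0 < a) (hx : t < joukowski a) :
    quadSubst a t - t = (t - a) * (t - a⁻¹) / (2 * (joukowski a - t)) := by
  have : joukowski a - t ≠ 0 := by linarith
  rw [quadSubst, eq_div_iff (by positivity), sub_mul, div_mul_cancel₀ _ (by positivity), joukowski]
  field_simp
  ring

theorem hasDerivAt_quadSubst (h0 : 0 < a) (hx : t < joukowski a) :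
    HasDerivAt (quadSubst a) ((t - a) * (t - a⁻¹) / (2 * (joukowski a - t) ^ 2)) t := by
  have hne : joukowski a - t ≠ 0 := by linarith
  have hnum : HasDerivAt (fun t : ℝ => 1 - t ^ 2) (-(2 * t)) t := by
    simpa using (hasDerivAt_pow 2 t).const_sub 1
  have hden : HasDerivAt (fun t : ℝ => 2 * (joukowski a - t)) (2 * -1) t :=
    ((hasDerivAt_id t).const_sub _).const_mul 2
  refine (hnum.div hden (by positivity [hne])).congr_deriv ?_
  have hinv : a⁻¹ = 2 * joukowski a - a := by rw [joukowski]; ring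
  have hmul : a * (2 * joukowski a - a) = 1 := by rw [← hinv]; exact mul_inv_cancel₀ h0.ne'
  rw [div_eq_div_iff (by positivity [hne]) (by positivity [hne]), hinv]
  linear_combination (-4 * (joukowski a - t) ^ 2) * hmul

theorem abs_deriv_mul_quadSubst (h0 : 0 < a) (hx : t < joukowski a) (hta : (t - a) * (t - a⁻¹) ≠ 0)
    (μ : ℂ) :
    |(t - a) * (t - a⁻¹) / (2 * (joukowski a - t) ^ 2)| • ((quadSubst a t : ℂ) ^ (μ - 1) /
      (√((a - quadSubst a t) * (a⁻¹ - quadSubst a t)) : ℂ)) =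
      (quadSubst a t : ℂ) ^ (μ - 1) / ((joukowski a - t : ℝ) : ℂ) := by
  have hpos : 0 < joukowski a - t := by linarith
  rw [sqrt_quadSubst h0 hx, abs_div, abs_of_pos (a := 2 * (joukowski a - t) ^ 2) (by positivity)]
  have hA : ((|(t - a) * (t - a⁻¹)| : ℝ) : ℂ) ≠ 0 := Complex.ofReal_ne_zero.2 (abs_pos.2 hta).ne'
  have hJ : ((joukowski a - t : ℝ) : ℂ) ≠ 0 := Complex.ofReal_ne_zero.2 hpos.ne'
  generalize |(t - a) * (t - a⁻¹)| = A at *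
  generalize joukowski a - t = J at *
  rw [Complex.real_smul]
  push_cast
  field_simp

theorem sqrt_sub_mul_inv_sub_sq (h0 : 0 < a) (h1 : a < 1) {w : ℝ} (hw : w < a) :
    √((a - w) * (a⁻¹ - w)) ^ 2 = w ^ 2 - 2 * w * joukowski a + 1 := by
  have hinv : 1 < a⁻¹ := (one_lt_inv₀ h0).2 h1
  rw [Real.sq_sqrt (mul_nonneg (by linarith) (by linarith)), joukowski]
  field_simp
  ring

theorem quadSubst_eq_of_sq {w : ℝ} (hx : t < joukowski a)
    (h : (t - w) ^ 2 = w ^ 2 - 2 * w * joukowski a + 1) : quadSubst a t = w := by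
  have : joukowski a - t ≠ 0 := by linarith
  rw [quadSubst, div_eq_iff (by positivity)]
  linarith

theorem quadSubst_mem (h0 : 0 < a) (h1 : a < 1) (ht : t ∈ Set.Ioo (-1) 1) (hta : t ≠ a) :
    quadSubst a t ∈ Set.Ioo 0 a := by
  have hx : t < joukowski a := ht.2.trans (one_lt_joukowski h0 h1)
  have hpos : 0 < joukowski a - t := by linarith
  constructor
  · exact div_pos (by nlinarith [ht.1, ht.2]) (by positivity [hpos])
  · have := sub_quadSubst h0 hx
    have hsq : 0 < (t - a) ^ 2 / (2 * (joukowski a - t)) :=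
      div_pos (by positivity [sub_ne_zero.2 hta]) (by positivity [hpos])
    linarith

theorem image_quadSubst_left (h0 : 0 < a) (h1 : a < 1) :
    quadSubst a '' Set.Ioo (-1) a = Set.Ioo 0 a := by
  have hJ := one_lt_joukowski h0 h1
  refine Set.Subset.antisymm ?_ fun w hw => ?_
  · rintro _ ⟨t, ht, rfl⟩
    exact quadSubst_mem h0 h1 ⟨ht.1, ht.2.trans h1⟩ ht.2.ne
  · have hR := sqrt_sub_mul_inv_sub_sq h0 h1 hw.2
    set R := √((a - w) * (a⁻¹ - w))
    have hR0 : 0 ≤ R := Real.sqrt_nonneg _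
    have hR1 : R < 1 + w := by
      refine lt_of_pow_lt_pow_left₀ 2 (by linarith [hw.1]) ?_
      nlinarith [hw.1]
    refine ⟨w - R, ⟨by linarith, by linarith [hw.2]⟩, quadSubst_eq_of_sq (by linarith [hw.2]) ?_⟩
    rw [← hR]
    ring

theorem image_quadSubst_right (h0 : 0 < a) (h1 : a < 1) :
    quadSubst a '' Set.Ioo a 1 = Set.Ioo 0 a := by
  have hJ := one_lt_joukowski h0 h1
  refine Set.Subset.antisymm ?_ fun w hw => ?_
  · rintro _ ⟨t, ht, rfl⟩
    exact quadSubst_mem h0 h1 ⟨by linarith [ht.1], ht.2⟩ ht.1.ne'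
  · have hR := sqrt_sub_mul_inv_sub_sq h0 h1 hw.2
    have hinv : 1 < a⁻¹ := (one_lt_inv₀ h0).2 h1
    have hlt : a - w < √((a - w) * (a⁻¹ - w)) := by
      refine Real.lt_sqrt_of_sq_lt ?_
      nlinarith [hw.2]
    set R := √((a - w) * (a⁻¹ - w))
    have hR1 : R < 1 - w := by
      refine lt_of_pow_lt_pow_left₀ 2 (by linarith [hw.2]) ?_
      nlinarith [hw.1]
    refine ⟨w + R, ⟨by linarith, by linarith⟩, quadSubst_eq_of_sq (by linarith [hw.2]) ?_⟩
    rw [← hR]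
    ring

theorem injOn_quadSubst_left (h0 : 0 < a) (h1 : a < 1) :
    Set.InjOn (quadSubst a) (Set.Ioo (-1) a) := by
  have hinv : 1 < a⁻¹ := (one_lt_inv₀ h0).2 h1
  refine Set.LeftInvOn.injOn (f₁' := fun w => w - √((a - w) * (a⁻¹ - w))) fun t ht => ?_
  have hx : t < joukowski a := (ht.2.trans h1).trans (one_lt_joukowski h0 h1)
  have hsgn : 0 ≤ (t - a) * (t - a⁻¹) := by nlinarith [ht.2]
  beta_reduce
  rw [sqrt_quadSubst h0 hx, abs_of_nonneg hsgn, ← quadSubst_sub_self h0 hx]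
  ring

theorem injOn_quadSubst_right (h0 : 0 < a) (h1 : a < 1) :
    Set.InjOn (quadSubst a) (Set.Ioo a 1) := by
  have hinv : 1 < a⁻¹ := (one_lt_inv₀ h0).2 h1
  refine Set.LeftInvOn.injOn (f₁' := fun w => w + √((a - w) * (a⁻¹ - w))) fun t ht => ?_
  have hx : t < joukowski a := ht.2.trans (one_lt_joukowski h0 h1)
  have hsgn : (t - a) * (t - a⁻¹) ≤ 0 := by nlinarith [ht.1, ht.2]
  beta_reduce
  rw [sqrt_quadSubst h0 hx, abs_of_nonpos hsgn, neg_div, ← quadSubst_sub_self h0 hx]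
  ring

theorem legendreQ_eq_integral_left (h0 : 0 < a) (h1 : a < 1) (μ : ℂ) :
    legendreQ a μ = ∫ t in Set.Ioo (-1) a,
      (quadSubst a t : ℂ) ^ (μ - 1) / ((joukowski a - t : ℝ) : ℂ) := by
  have hinv : 1 < a⁻¹ := (one_lt_inv₀ h0).2 h1
  have hx (t : ℝ) (ht : t ∈ Set.Ioo (-1) a) : t < joukowski a :=
    (ht.2.trans h1).trans (one_lt_joukowski h0 h1)
  rw [legendreQ, ← image_quadSubst_left h0 h1, integral_image_eq_integral_abs_deriv_smul
    measurableSet_Ioo (fun t ht => (hasDerivAt_quadSubst h0 (hx t ht)).hasDerivWithinAt)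
    (injOn_quadSubst_left h0 h1)]
  refine setIntegral_congr_fun measurableSet_Ioo fun t ht =>
    abs_deriv_mul_quadSubst h0 (hx t ht) (mul_ne_zero ?_ ?_) μ
  · linarith [ht.2]
  · linarith [ht.2]

theorem legendreQ_eq_integral_right (h0 : 0 < a) (h1 : a < 1) (μ : ℂ) :
    legendreQ a μ = ∫ t in Set.Ioo a 1,
      (quadSubst a t : ℂ) ^ (μ - 1) / ((joukowski a - t : ℝ) : ℂ) := by
  have hinv : 1 < a⁻¹ := (one_lt_inv₀ h0).2 h1
  have hx (t : ℝ) (ht : t ∈ Set.Ioo a 1) : t < joukowski a :=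
    ht.2.trans (one_lt_joukowski h0 h1)
  rw [legendreQ, ← image_quadSubst_right h0 h1, integral_image_eq_integral_abs_deriv_smul
    measurableSet_Ioo (fun t ht => (hasDerivAt_quadSubst h0 (hx t ht)).hasDerivWithinAt)
    (injOn_quadSubst_right h0 h1)]
  refine setIntegral_congr_fun measurableSet_Ioo fun t ht =>
    abs_deriv_mul_quadSubst h0 (hx t ht) (mul_ne_zero ?_ ?_) μ
  · linarith [ht.1]
  · linarith [ht.2]

end quadSubst

/-! ### The hypergeometric expansion -/

theorem poch_zero (a : ℂ) : poch a 0 = 1 := by simp [poch]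

theorem poch_succ (a : ℂ) (k : ℕ) : poch a (k + 1) = poch a k * (a + k) := by
  simp [poch, ascPochhammer_succ_eval]

theorem Gamma_add_natCast {a : ℂ} (ha : 0 < a.re) (k : ℕ) :
    Complex.Gamma (a + k) = poch a k * Complex.Gamma a := by
  have hne (m : ℕ) : a ≠ -m := by
    rintro rfl
    simp [(m.cast_nonneg : (0 : ℝ) ≤ m).not_gt] at ha
  rw [poch, ← Complex.Gamma_add_nat_div_Gamma_eq a hne,
    div_mul_cancel₀ _ (Complex.Gamma_ne_zero_of_re_pos ha)]

theorem poch_ne_zero {a : ℂ} (ha : 0 < a.re) (k : ℕ) : poch a k ≠ 0 :=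
  left_ne_zero_of_mul (Gamma_add_natCast ha k ▸
    Complex.Gamma_ne_zero_of_re_pos (re_add_natCast_pos ha k))

theorem poch_two_mul (a : ℂ) (k : ℕ) :
    poch a (2 * k) = 4 ^ k * poch (a / 2) k * poch ((a + 1) / 2) k := by
  induction k with
  | zero => simp [poch_zero]
  | succ k ih =>
    rw [show 2 * (k + 1) = 2 * k + 1 + 1 by ring, poch_succ, poch_succ, poch_succ, poch_succ, ih]
    push_cast
    ring

theorem factorial_two_mul_eq_poch (k : ℕ) :
    ((2 * k).factorial : ℂ) = 4 ^ k * k.factorial * poch (1 / 2) k := by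
  induction k with
  | zero => simp [poch_zero]
  | succ k ih =>
    rw [show 2 * (k + 1) = 2 * k + 1 + 1 by ring, Nat.factorial_succ, Nat.factorial_succ,
      Nat.factorial_succ k, poch_succ]
    push_cast
    rw [ih]
    ring

theorem norm_one_sub_sq_cpow_le {μ : ℂ} (hμ : 1 ≤ μ.re) {t : ℝ} (ht : t ∈ Set.Ioc (-1) 1) :
    ‖((1 - t ^ 2 : ℝ) : ℂ) ^ (μ - 1)‖ ≤ 1 := by
  have h0 : 0 ≤ 1 - t ^ 2 := by nlinarith [ht.1, ht.2]
  have hμ1 : 0 ≤ (μ - 1).re := by simpa using hμ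
  rcases h0.eq_or_lt with h | h
  · rw [← h, Complex.ofReal_zero]
    by_cases h' : μ - 1 = 0
    · simp [h']
    · simp [Complex.zero_cpow h']
  · rw [Complex.norm_cpow_eq_rpow_re_of_pos h]
    exact Real.rpow_le_one h0 (by nlinarith [sq_nonneg t]) hμ1

theorem integrableOn_one_sub_sq_cpow {μ : ℂ} (hμ : 1 ≤ μ.re) :
    IntegrableOn (fun t : ℝ => ((1 - t ^ 2 : ℝ) : ℂ) ^ (μ - 1)) (Set.Ioc (-1) 1) := by
  refine Measure.integrableOn_of_bounded (M := 1) (by simp) ?_ ?_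
  · exact (Measurable.pow_const (by fun_prop) _).aestronglyMeasurable
  · filter_upwards [ae_restrict_mem measurableSet_Ioc] with t ht
    exact norm_one_sub_sq_cpow_le hμ ht

/-- The moments of `(1 - t²)^{μ-1}`. -/
def gegenbauerMoment (μ : ℂ) (n : ℕ) : ℂ :=
  ∫ t in (-1 : ℝ)..1, ((1 - t ^ 2 : ℝ) : ℂ) ^ (μ - 1) * (t : ℂ) ^ n

theorem gegenbauerMoment_odd (μ : ℂ) (k : ℕ) : gegenbauerMoment μ (2 * k + 1) = 0 := by
  have h := intervalIntegral.integral_comp_neg (a := -1) (b := 1)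
    (fun t : ℝ => ((1 - t ^ 2 : ℝ) : ℂ) ^ (μ - 1) * (t : ℂ) ^ (2 * k + 1))
  have h_neg : gegenbauerMoment μ (2 * k + 1) = - gegenbauerMoment μ (2 * k + 1) := by
    rw [neg_neg] at h
    conv_lhs => rw [gegenbauerMoment, ← h]
    rw [gegenbauerMoment, ← intervalIntegral.integral_neg]
    refine intervalIntegral.integral_congr fun t _ => ?_
    have : (-(t : ℂ)) ^ (2 * k + 1) = - (t : ℂ) ^ (2 * k + 1) := Odd.neg_pow ⟨k, rfl⟩ _
    simp [this]
  exact self_eq_neg.1 h_neg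

theorem two_mul_integral_eq_betaIntegral (μ : ℂ) (k : ℕ) :
    2 * ∫ t in (0 : ℝ)..1, ((1 - t ^ 2 : ℝ) : ℂ) ^ (μ - 1) * (t : ℂ) ^ (2 * k) =
      Complex.betaIntegral (1 / 2 + k) μ := by
  have himg : (fun t : ℝ => t ^ 2) '' Set.Ioo 0 1 = Set.Ioo 0 1 := by
    ext s
    constructor
    · rintro ⟨t, ht, rfl⟩
      exact ⟨pow_pos ht.1 2, pow_lt_one₀ ht.1.le ht.2 two_ne_zero⟩
    · intro hs
      exact ⟨√s, ⟨Real.sqrt_pos.2 hs.1, (Real.sqrt_lt' one_pos).2 (by simpa using hs.2)⟩,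
        Real.sq_sqrt hs.1.le⟩
  have hinj : Set.InjOn (fun t : ℝ => t ^ 2) (Set.Ioo 0 1) := fun s hs t ht h =>
    (sq_eq_sq₀ hs.1.le ht.1.le).1 h
  rw [Complex.betaIntegral, intervalIntegral.integral_of_le zero_le_one,
    intervalIntegral.integral_of_le zero_le_one, integral_Ioc_eq_integral_Ioo,
    integral_Ioc_eq_integral_Ioo, ← integral_const_mul]
  conv_rhs => rw [← himg]
  rw [integral_image_eq_integral_abs_deriv_smul measurableSet_Ioo
    (fun t _ => (hasDerivAt_pow 2 t).hasDerivWithinAt) hinj]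
  refine setIntegral_congr_fun measurableSet_Ioo fun t ht => ?_
  have ht0 : (t : ℂ) ≠ 0 := by exact_mod_cast ht.1.ne'
  have h_pow : ((t ^ 2 : ℝ) : ℂ) ^ (1 / 2 + (k : ℂ) - 1) * t = (t : ℂ) ^ (2 * k) := by
    rw [sq, Complex.ofReal_mul, Complex.mul_cpow_ofReal_nonneg ht.1.le ht.1.le,
      ← Complex.cpow_add _ _ ht0]
    nth_rewrite 2 [← Complex.cpow_one (t : ℂ)]
    rw [← Complex.cpow_add _ _ ht0, ← Complex.cpow_natCast]
    congr 1
    push_cast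
    ring
  rw [← h_pow, Complex.real_smul, abs_of_pos (by simpa using ht.1)]
  push_cast
  ring

theorem gegenbauerMoment_even {μ : ℂ} (hμ : 1 ≤ μ.re) (k : ℕ) :
    gegenbauerMoment μ (2 * k) = Complex.betaIntegral (1 / 2 + k) μ := by
  have h_int : IntervalIntegrable
      (fun t : ℝ => ((1 - t ^ 2 : ℝ) : ℂ) ^ (μ - 1) * (t : ℂ) ^ (2 * k)) volume (-1) 1 := by
    refine IntervalIntegrable.mul_continuousOn ?_ (by fun_prop)
    rw [intervalIntegrable_iff_integrableOn_Ioc_of_le (by norm_num)]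
    exact integrableOn_one_sub_sq_cpow hμ
  have h := intervalIntegral.integral_comp_neg (a := 0) (b := 1)
    (fun t : ℝ => ((1 - t ^ 2 : ℝ) : ℂ) ^ (μ - 1) * (t : ℂ) ^ (2 * k))
  rw [neg_zero] at h
  have hl : Set.uIcc (-1 : ℝ) 0 ⊆ Set.uIcc (-1) 1 :=
    Set.uIcc_subset_uIcc_left (by rw [Set.uIcc_of_le] <;> norm_num)
  have hr : Set.uIcc (0 : ℝ) 1 ⊆ Set.uIcc (-1) 1 :=
    Set.uIcc_subset_uIcc_right (by rw [Set.uIcc_of_le] <;> norm_num)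
  rw [← two_mul_integral_eq_betaIntegral, gegenbauerMoment,
    ← intervalIntegral.integral_add_adjacent_intervals (h_int.mono_set hl) (h_int.mono_set hr), ← h]
  refine Eq.trans ?_ (two_mul _).symm
  congr 1
  refine intervalIntegral.integral_congr fun t _ => ?_
  simp [pow_mul]

theorem one_sub_div_joukowski_pos {a : ℝ} (h0 : 0 < a) (h1 : a < 1) {t : ℝ} (ht : t ≤ 1) :
    0 < 1 - t / joukowski a := by
  have hJ := one_lt_joukowski h0 h1
  rw [sub_pos, div_lt_one (one_pos.trans hJ)]
  exact ht.trans_lt hJ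

theorem cpow_inv_two_mul_div {y : ℝ} (hy : 0 < y) (μ : ℂ) :
    (((2 * y)⁻¹ : ℝ) : ℂ) ^ (μ - 1) / (y : ℂ) = 2 * ((2 * y : ℝ) : ℂ) ^ (-μ) := by
  have hy2 : 0 < 2 * y := by positivity
  have hyc : (y : ℂ) ≠ 0 := by exact_mod_cast hy.ne'
  have hy2c : ((2 * y : ℝ) : ℂ) ≠ 0 := by exact_mod_cast hy2.ne'
  have harg : ((2 * y : ℝ) : ℂ).arg ≠ Real.pi := by
    rw [Complex.arg_ofReal_of_nonneg hy2.le]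
    exact Real.pi_pos.ne
  rw [Complex.ofReal_inv, Complex.inv_cpow _ _ harg, Complex.cpow_sub _ _ hy2c, Complex.cpow_one,
    Complex.cpow_neg]
  push_cast
  field_simp

theorem quadSubst_cpow_div {a : ℝ} (h0 : 0 < a) (h1 : a < 1) (μ : ℂ) {t : ℝ}
    (ht : t ∈ Set.Ioc (-1) 1) :
    (quadSubst a t : ℂ) ^ (μ - 1) / ((joukowski a - t : ℝ) : ℂ) =
      ((1 - t ^ 2 : ℝ) : ℂ) ^ (μ - 1) * (2 * (2 : ℂ) ^ (-μ) * (joukowski a : ℂ) ^ (-μ) *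
        ((1 - t / joukowski a : ℝ) : ℂ) ^ (-μ)) := by
  have hJ0 : 0 < joukowski a := one_pos.trans (one_lt_joukowski h0 h1)
  have hsub := one_sub_div_joukowski_pos h0 h1 ht.2
  have hfac : joukowski a - t = joukowski a * (1 - t / joukowski a) := by field_simp
  have hy : 0 < joukowski a - t := hfac ▸ mul_pos hJ0 hsub
  rw [quadSubst, div_eq_mul_inv (1 - t ^ 2), Complex.ofReal_mul,
    Complex.mul_cpow_ofReal_nonneg (by nlinarith [ht.1, ht.2]) (by positivity), mul_div_assoc,
    cpow_inv_two_mul_div hy, hfac, Complex.ofReal_mul 2,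
    Complex.mul_cpow_ofReal_nonneg zero_le_two (by positivity),
    Complex.ofReal_mul (joukowski a), Complex.mul_cpow_ofReal_nonneg hJ0.le hsub.le]
  push_cast
  ring

theorem integrableOn_quadSubst_cpow_div {a : ℝ} (h0 : 0 < a) (h1 : a < 1) {μ : ℂ}
    (hμ : 1 ≤ μ.re) :
    IntegrableOn (fun t : ℝ => (quadSubst a t : ℂ) ^ (μ - 1) / ((joukowski a - t : ℝ) : ℂ))
      (Set.Ioc (-1) 1) := by
  refine IntegrableOn.congr_fun ?_ (fun t ht => (quadSubst_cpow_div h0 h1 μ ht).symm)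
    measurableSet_Ioc
  rw [← intervalIntegrable_iff_integrableOn_Ioc_of_le (by norm_num)]
  refine IntervalIntegrable.mul_continuousOn ?_ ?_
  · rw [intervalIntegrable_iff_integrableOn_Ioc_of_le (by norm_num)]
    exact integrableOn_one_sub_sq_cpow hμ
  · refine continuousOn_const.mul (ContinuousOn.cpow (by fun_prop) continuousOn_const ?_)
    intro t ht
    rw [Set.uIcc_of_le (by norm_num)] at ht
    rw [Complex.ofReal_mem_slitPlane]
    exact one_sub_div_joukowski_pos h0 h1 ht.2

theorem two_mul_legendreQ {a : ℝ} (h0 : 0 < a) (h1 : a < 1) {μ : ℂ} (hμ : 1 ≤ μ.re) :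
    2 * legendreQ a μ = ∫ t in Set.Ioc (-1 : ℝ) 1,
      (quadSubst a t : ℂ) ^ (μ - 1) / ((joukowski a - t : ℝ) : ℂ) := by
  have ha : -1 ≤ a := by linarith
  have h_int := integrableOn_quadSubst_cpow_div h0 h1 hμ
  rw [two_mul]
  nth_rewrite 1 [legendreQ_eq_integral_left h0 h1]
  rw [legendreQ_eq_integral_right h0 h1, ← integral_Ioc_eq_integral_Ioo,
    ← integral_Ioc_eq_integral_Ioo, ← Set.Ioc_union_Ioc_eq_Ioc ha h1.le,
    setIntegral_union (Set.Ioc_disjoint_Ioc_of_le le_rfl) measurableSet_Ioc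
      (h_int.mono_set (Set.Ioc_subset_Ioc_right h1.le))
      (h_int.mono_set (Set.Ioc_subset_Ioc_left ha))]

theorem legendreQ_eq_integral_Ioc {a : ℝ} (h0 : 0 < a) (h1 : a < 1) {μ : ℂ} (hμ : 1 ≤ μ.re) :
    legendreQ a μ = (2 : ℂ) ^ (-μ) * (joukowski a : ℂ) ^ (-μ) * ∫ t in Set.Ioc (-1 : ℝ) 1,
      ((1 - t ^ 2 : ℝ) : ℂ) ^ (μ - 1) * (1 - (t : ℂ) / joukowski a) ^ (-μ) := by
  refine mul_left_cancel₀ two_ne_zero ((two_mul_legendreQ h0 h1 hμ).trans ?_)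
  rw [← integral_const_mul, ← integral_const_mul]
  refine setIntegral_congr_fun measurableSet_Ioc fun t ht => ?_
  rw [quadSubst_cpow_div h0 h1 μ ht]
  push_cast
  ring

/-- The constant `√π 2^{-μ} Γ(μ) / Γ(μ + 1/2)` in the expansion of `legendreQ a μ` in descending
powers of `joukowski a`. -/
def legendreQNorm (μ : ℂ) : ℂ :=
  (2 : ℂ) ^ (-μ) * (Complex.Gamma μ / Complex.Gamma (μ + 1 / 2) * Complex.Gamma (1 / 2))

theorem poch_mul_gegenbauerMoment {μ : ℂ} (hμ : 1 ≤ μ.re) (k : ℕ) :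
    poch μ (2 * k) / (2 * k).factorial * gegenbauerMoment μ (2 * k) =
      Complex.Gamma μ / Complex.Gamma (μ + 1 / 2) * Complex.Gamma (1 / 2) *
        (b k μ / k.factorial) := by
  have hμ0 : 0 < μ.re := one_pos.trans_le hμ
  have hhalf : 0 < (1 / 2 : ℂ).re := by norm_num
  have hμ_half : 0 < (μ + 1 / 2).re := by
    rw [Complex.add_re]
    exact add_pos hμ0 hhalf
  have hp_half : poch (1 / 2) k ≠ 0 := poch_ne_zero hhalf k
  have hf : (k.factorial : ℂ) ≠ 0 := by exact_mod_cast k.factorial_ne_zero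
  have hG := Complex.Gamma_ne_zero_of_re_pos hμ_half
  rw [gegenbauerMoment_even hμ, poch_two_mul, factorial_two_mul_eq_poch, b,
    Complex.betaIntegral_eq_Gamma_mul_div _ _ (re_add_natCast_pos hhalf k) hμ0,
    show (1 / 2 + (k : ℂ) + μ) = μ + 1 / 2 + k by ring,
    Gamma_add_natCast hhalf, Gamma_add_natCast hμ_half]
  generalize Complex.Gamma (μ + 1 / 2) = G at *
  field_simp

theorem integral_mul_poch_div_factorial (μ : ℂ) (J : ℝ) (n : ℕ) :
    ∫ t in Set.Ioc (-1 : ℝ) 1, ((1 - t ^ 2 : ℝ) : ℂ) ^ (μ - 1) *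
      (poch μ n / n.factorial * ((t : ℂ) / J) ^ n) =
      poch μ n / n.factorial * gegenbauerMoment μ n * ((J : ℂ) ^ n)⁻¹ := by
  rw [gegenbauerMoment, intervalIntegral.integral_of_le (by norm_num), ← integral_const_mul,
    ← integral_mul_const]
  refine setIntegral_congr_fun measurableSet_Ioc fun t _ => ?_
  rw [div_pow]
  ring

theorem hasSum_integral_one_sub_div_cpow {μ : ℂ} (hμ : 1 ≤ μ.re) {J : ℝ} (hJ : 1 < J) :
    HasSum (fun n : ℕ => poch μ n / n.factorial * gegenbauerMoment μ n * ((J : ℂ) ^ n)⁻¹)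
      (∫ t in Set.Ioc (-1 : ℝ) 1, ((1 - t ^ 2 : ℝ) : ℂ) ^ (μ - 1) *
        (1 - (t : ℂ) / J) ^ (-μ)) := by
  have hJ0 : 0 < J := one_pos.trans hJ
  have hnorm : ∀ᵐ t : ℝ ∂volume.restrict (Set.Ioc (-1) 1), ‖(t : ℂ) / J‖ ≤ J⁻¹ := by
    filter_upwards [ae_restrict_mem measurableSet_Ioc] with t ht
    rw [norm_div, Complex.norm_real, Complex.norm_real, Real.norm_of_nonneg hJ0.le,
      div_eq_mul_inv]
    exact mul_le_of_le_one_left (by positivity) (abs_le.2 ⟨ht.1.le, ht.2⟩)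
  simp_rw [← integral_mul_poch_div_factorial]
  refine hasSum_integral_mul (integrableOn_one_sub_sq_cpow hμ)
    (fun n => Continuous.aestronglyMeasurable (by fun_prop))
    (summable_norm_poch_div_factorial μ (by positivity) (inv_lt_one_of_one_lt₀ hJ))
    (fun n => ?_) ?_
  · filter_upwards [hnorm] with t ht
    rw [norm_mul, norm_pow]
    gcongr
  · filter_upwards [hnorm] with t ht
    exact hasSum_poch_div_factorial _ (ht.trans_lt (inv_lt_one_of_one_lt₀ hJ))

theorem hasSum_legendreQ {a : ℝ} (h0 : 0 < a) (h1 : a < 1) {μ : ℂ} (hμ : 1 ≤ μ.re) :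
    HasSum (fun k : ℕ => legendreQNorm μ *
      (b k μ / k.factorial * (joukowski a : ℂ) ^ (-(μ + 2 * k)))) (legendreQ a μ) := by
  have hJ := one_lt_joukowski h0 h1
  have hJc : (joukowski a : ℂ) ≠ 0 := by exact_mod_cast (one_pos.trans hJ).ne'
  have h_sum := hasSum_integral_one_sub_div_cpow hμ hJ
  rw [← (mul_right_injective₀ (two_ne_zero : (2 : ℕ) ≠ 0)).hasSum_iff] at h_sum
  · rw [legendreQ_eq_integral_Ioc h0 h1 hμ]
    convert! h_sum.mul_left ((2 : ℂ) ^ (-μ) * (joukowski a : ℂ) ^ (-μ)) using 1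
    funext k
    rw [Function.comp_apply, poch_mul_gegenbauerMoment hμ, neg_add, Complex.cpow_add _ _ hJc,
      Complex.cpow_neg _ (2 * (k : ℂ)), legendreQNorm,
      show (2 * (k : ℂ)) = ((2 * k : ℕ) : ℂ) by push_cast; ring, Complex.cpow_natCast]
    ring
  · intro n hn
    obtain ⟨k, rfl | rfl⟩ := n.even_or_odd'
    · exact absurd ⟨k, rfl⟩ hn
    · simp [gegenbauerMoment_odd]

/-! ### Shifting horizontal contours -/

theorem tendsto_integral_vertical_side {f : ℂ → ℂ} {c d : ℝ} (hcd : c ≤ d) {g : ℝ → ℝ}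
    (hg : Tendsto g atTop (𝓝 0)) {R : ℝ}
    (hfg : ∀ z : ℂ, z.im ∈ Set.Icc c d → R ≤ |z.re| → ‖f z‖ ≤ g |z.re|) {s : ℝ} (hs : |s| = 1) :
    Tendsto (fun T : ℝ => ∫ y : ℝ in c..d, f ((s * T : ℝ) + y * Complex.I)) atTop (𝓝 0) := by
  have hlim : Tendsto (fun T => g T * |d - c|) atTop (𝓝 0) := by
    simpa using hg.mul_const |d - c|
  refine squeeze_zero_norm' ?_ hlim
  filter_upwards [eventually_ge_atTop (max R 0)] with T hT
  have habs : |s * T| = T := by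
    rw [abs_mul, hs, one_mul, abs_of_nonneg ((le_max_right _ _).trans hT)]
  refine intervalIntegral.norm_integral_le_of_norm_le_const fun y hy => ?_
  rw [Set.uIoc_of_le hcd] at hy
  simpa [habs] using hfg ((s * T : ℝ) + y * Complex.I) (by simpa using ⟨hy.1.le, hy.2⟩)
    (by simpa [habs] using (le_max_left _ _).trans hT)

theorem integral_horizontal_sub_integral_horizontal {f : ℂ → ℂ} {c d : ℝ} (hcd : c ≤ d)
    (hc : ContinuousOn f {z | z.im ∈ Set.Icc c d})
    (hd : DifferentiableOn ℂ f {z | z.im ∈ Set.Ioo c d}) (T : ℝ) :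
    (∫ x : ℝ in -T..T, f (x + c * Complex.I)) - (∫ x : ℝ in -T..T, f (x + d * Complex.I)) =
      Complex.I * (∫ y : ℝ in c..d, f ((-1 * T : ℝ) + y * Complex.I)) -
        Complex.I * (∫ y : ℝ in c..d, f ((1 * T : ℝ) + y * Complex.I)) := by
  have hrect := Complex.integral_boundary_rect_eq_zero_of_continuousOn_of_differentiableOn f
    ⟨-T, c⟩ ⟨T, d⟩
    (hc.mono fun z hz => Set.uIcc_of_le hcd ▸ hz.2)
    (hd.mono fun z hz => by
      simpa only [Set.mem_ofPred_eq, Set.mem_preimage, min_eq_left hcd, max_eq_right hcd]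
        using hz.2)
  simp only [smul_eq_mul] at hrect
  rw [neg_one_mul, one_mul]
  linear_combination hrect

theorem integral_horizontal_eq {f : ℂ → ℂ} {c d : ℝ} (hcd : c ≤ d)
    (hc : ContinuousOn f {z | z.im ∈ Set.Icc c d})
    (hd : DifferentiableOn ℂ f {z | z.im ∈ Set.Ioo c d})
    {g : ℝ → ℝ} (hg : Tendsto g atTop (𝓝 0)) {R : ℝ}
    (hfg : ∀ z : ℂ, z.im ∈ Set.Icc c d → R ≤ |z.re| → ‖f z‖ ≤ g |z.re|)
    (hic : Integrable fun x : ℝ => f (x + c * Complex.I))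
    (hid : Integrable fun x : ℝ => f (x + d * Complex.I)) :
    ∫ x : ℝ, f (x + c * Complex.I) = ∫ x : ℝ, f (x + d * Complex.I) := by
  have h_horizontal :=
    (intervalIntegral_tendsto_integral hic tendsto_neg_atTop_atBot tendsto_id).sub
      (intervalIntegral_tendsto_integral hid tendsto_neg_atTop_atBot tendsto_id)
  simp only [id, integral_horizontal_sub_integral_horizontal hcd hc hd] at h_horizontal
  have h_vertical :=
    ((tendsto_integral_vertical_side hcd hg hfg (s := -1) (by simp)).const_mul Complex.I).sub
      ((tendsto_integral_vertical_side hcd hg hfg (s := 1) (by simp)).const_mul Complex.I)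
  rw [mul_zero, sub_zero] at h_vertical
  exact sub_eq_zero.1 (tendsto_nhds_unique h_horizontal h_vertical)

/-! ### A contour integral over the upper half-plane -/

theorem integrableOn_rpow_mul_one_add_inv :
    IntegrableOn (fun x : ℝ => x ^ (-(1 / 2) : ℝ) * (1 + x)⁻¹) (Set.Ioi 0) := by
  have hm : Measurable fun x : ℝ => x ^ (-(1 / 2) : ℝ) * (1 + x)⁻¹ := by fun_prop
  rw [← Set.Ioc_union_Ioi_eq_Ioi zero_le_one, integrableOn_union]
  constructor
  · have h_dom : IntegrableOn (fun x : ℝ => x ^ (-(1 / 2) : ℝ)) (Set.Ioc 0 1) := by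
      rw [integrableOn_Ioc_iff_integrableOn_Ioo,
        intervalIntegral.integrableOn_Ioo_rpow_iff one_pos]
      norm_num
    refine h_dom.mono' hm.aestronglyMeasurable ?_
    filter_upwards [ae_restrict_mem measurableSet_Ioc] with x hx
    have hx0 := hx.1
    rw [Real.norm_of_nonneg (by positivity)]
    exact mul_le_of_le_one_right (by positivity) (inv_le_one_of_one_le₀ (by linarith))
  · have h_dom : IntegrableOn (fun x : ℝ => x ^ (-(3 / 2) : ℝ)) (Set.Ioi 1) :=
      integrableOn_Ioi_rpow_of_lt (by norm_num) one_pos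
    refine h_dom.mono' hm.aestronglyMeasurable ?_
    filter_upwards [ae_restrict_mem measurableSet_Ioi] with x hx
    have hx0 : 0 < x := one_pos.trans hx
    rw [Real.norm_of_nonneg (by positivity)]
    calc x ^ (-(1 / 2) : ℝ) * (1 + x)⁻¹ ≤ x ^ (-(1 / 2) : ℝ) * x⁻¹ := by
          gcongr
          linarith
      _ = x ^ (-(3 / 2) : ℝ) := by
          rw [← Real.rpow_neg_one, ← Real.rpow_add hx0]
          norm_num

theorem integrable_abs_rpow_mul_one_add_abs_inv :
    Integrable fun x : ℝ => |x| ^ (-(1 / 2) : ℝ) * (1 + |x|)⁻¹ := by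
  have hpos : IntegrableOn (fun x : ℝ => |x| ^ (-(1 / 2) : ℝ) * (1 + |x|)⁻¹) (Set.Ioi 0) :=
    integrableOn_rpow_mul_one_add_inv.congr_fun
      (fun x hx => by simp only [abs_of_pos (Set.mem_Ioi.1 hx)]) measurableSet_Ioi
  have hneg : IntegrableOn (fun x : ℝ => |x| ^ (-(1 / 2) : ℝ) * (1 + |x|)⁻¹) (Set.Iio 0) := by
    have h_comp := IntegrableOn.comp_neg_Iio (c := (0 : ℝ)) (μ := volume) (by rwa [neg_zero])
    simpa only [abs_neg] using h_comp
  rw [← integrableOn_univ, ← Set.Iio_union_Ici (a := (0 : ℝ)), integrableOn_union]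
  exact ⟨hneg, (integrableOn_Ici_iff_integrableOn_Ioi).2 hpos⟩

theorem rpow_neg_half_le {u v : ℝ} (hu : 0 < u) (h : u ≤ v) :
    v ^ (-(1 / 2) : ℝ) ≤ u ^ (-(1 / 2) : ℝ) :=
  Real.rpow_le_rpow_of_nonpos hu h (by norm_num)

theorem rpow_neg_half_mul_mul_le_of_le {m u v w : ℝ} (hm : 0 < m) (hm1 : m ≤ 1) (hu : 0 < u)
    (hv : m ≤ v) (hw : m ≤ w) (huv : u ≤ v) (huw : u ≤ w) :
    u ^ (-(1 / 2) : ℝ) * v ^ (-(1 / 2) : ℝ) * w ^ (-(1 / 2) : ℝ) ≤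
      2 / m * (u ^ (-(1 / 2) : ℝ) * (1 + u)⁻¹) := by
  set n := m / 2 * (1 + u) with hn
  have hn0 : 0 < n := by positivity
  have hmu : m * u ≤ u := mul_le_of_le_one_left hu.le hm1
  have hnv : n ≤ v := by linarith
  have hnw : n ≤ w := by linarith
  have hw0 : 0 ≤ w := hm.le.trans hw
  calc u ^ (-(1 / 2) : ℝ) * v ^ (-(1 / 2) : ℝ) * w ^ (-(1 / 2) : ℝ)
      ≤ u ^ (-(1 / 2) : ℝ) * n ^ (-(1 / 2) : ℝ) * n ^ (-(1 / 2) : ℝ) := by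
        gcongr u ^ _ * ?_ * ?_
        · exact rpow_neg_half_le hn0 hnv
        · exact rpow_neg_half_le hn0 hnw
    _ = u ^ (-(1 / 2) : ℝ) * n⁻¹ := by
        rw [mul_assoc, ← Real.rpow_add hn0, ← Real.rpow_neg_one]
        norm_num
    _ = _ := by
        rw [hn]
        field_simp

theorem rpow_neg_half_mul_mul_le {m u v w : ℝ} (hm : 0 < m) (hm1 : m ≤ 1) (hu : 0 < u)
    (hv : 0 < v) (hw : 0 < w) (huv : 2 * m ≤ u + v) (hvw : 2 * m ≤ v + w)
    (huw : 2 * m ≤ u + w) :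
    u ^ (-(1 / 2) : ℝ) * v ^ (-(1 / 2) : ℝ) * w ^ (-(1 / 2) : ℝ) ≤
      2 / m * (u ^ (-(1 / 2) : ℝ) * (1 + u)⁻¹ + v ^ (-(1 / 2) : ℝ) * (1 + v)⁻¹ +
        w ^ (-(1 / 2) : ℝ) * (1 + w)⁻¹) := by
  have hpos (x : ℝ) (hx : 0 < x) : 0 ≤ 2 / m * (x ^ (-(1 / 2) : ℝ) * (1 + x)⁻¹) := by positivity
  have hpu := hpos u hu
  have hpv := hpos v hv
  have hpw := hpos w hw
  rw [mul_add, mul_add]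
  by_cases hu_min : u ≤ v ∧ u ≤ w
  · linarith [rpow_neg_half_mul_mul_le_of_le hm hm1 hu (v := v) (w := w) (by linarith)
      (by linarith) hu_min.1 hu_min.2]
  by_cases hv_min : v ≤ u ∧ v ≤ w
  · linarith [rpow_neg_half_mul_mul_le_of_le hm hm1 hv (v := u) (w := w) (by linarith)
      (by linarith) hv_min.1 hv_min.2]
  have hw_min : w ≤ u ∧ w ≤ v := by grind
  linarith [rpow_neg_half_mul_mul_le_of_le hm hm1 hw (v := u) (w := v) (by linarith)
    (by linarith) hw_min.1 hw_min.2]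

/-- The function `|x|^{-1/2} |x - a|^{-1/2} |x - b|^{-1/2}`, which dominates `branchFun a b ν` on
horizontal lines when `Re ν = -1/2`. -/
def tripleSing (a b x : ℝ) : ℝ :=
  |x| ^ (-(1 / 2) : ℝ) * |x - a| ^ (-(1 / 2) : ℝ) * |x - b| ^ (-(1 / 2) : ℝ)

theorem ae_ne_zero_and_ne_and_ne (a b : ℝ) : ∀ᵐ x : ℝ, x ≠ 0 ∧ x ≠ a ∧ x ≠ b := by
  filter_upwards [Measure.ae_ne volume 0, Measure.ae_ne volume a, Measure.ae_ne volume b]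
    with x h0 ha hb using ⟨h0, ha, hb⟩

theorem sub_le_abs_sub_add_abs_sub (p q x : ℝ) : q - p ≤ |x - p| + |x - q| := by
  linarith [le_abs_self (x - p), neg_abs_le (x - q)]

theorem integrable_tripleSing {a b : ℝ} (h0 : 0 < a) (hab : a < b) :
    Integrable (tripleSing a b) := by
  obtain ⟨m, hm, hm1, hma, hmb⟩ : ∃ m : ℝ, 0 < m ∧ m ≤ 1 ∧ 2 * m ≤ a ∧ 2 * m ≤ b - a := by
    have h_min : min (min (a / 2) ((b - a) / 2)) 1 ≤ min (a / 2) ((b - a) / 2) := min_le_left _ _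
    exact ⟨min (min (a / 2) ((b - a) / 2)) 1, by simp [h0, hab], min_le_right _ _,
      by linarith [h_min.trans (min_le_left _ _)], by linarith [h_min.trans (min_le_right _ _)]⟩
  have h_int := integrable_abs_rpow_mul_one_add_abs_inv
  refine (((h_int.add (h_int.comp_sub_right a)).add (h_int.comp_sub_right b)).const_mul
    (2 / m)).mono' (Measurable.aestronglyMeasurable (by unfold tripleSing; fun_prop)) ?_
  filter_upwards [ae_ne_zero_and_ne_and_ne a b] with x ⟨hx0, hxa, hxb⟩
  rw [tripleSing, Real.norm_of_nonneg (by positivity)]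
  have h0a := sub_le_abs_sub_add_abs_sub 0 a x
  have h0b := sub_le_abs_sub_add_abs_sub 0 b x
  simp only [sub_zero] at h0a h0b
  exact rpow_neg_half_mul_mul_le hm hm1 (abs_pos.2 hx0) (abs_pos.2 (sub_ne_zero.2 hxa))
    (abs_pos.2 (sub_ne_zero.2 hxb)) (by linarith)
    (by linarith [sub_le_abs_sub_add_abs_sub a b x]) (by linarith)

/-- The function `w ^ ν (w - a)^{-1/2} (w - b)^{-1/2}`, with principal branches: it is holomorphic
in the upper half-plane and continuous up to the real line away from `0`, `a`, `b`. -/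
def branchFun (a b : ℝ) (ν w : ℂ) : ℂ :=
  w ^ ν * (w - a) ^ (-(1 / 2) : ℂ) * (w - b) ^ (-(1 / 2) : ℂ)

theorem norm_cpow_neg_one_half (w : ℂ) : ‖w ^ (-(1 / 2) : ℂ)‖ = ‖w‖ ^ (-(1 / 2) : ℝ) := by
  rw [show (-(1 / 2) : ℂ) = ((-(1 / 2) : ℝ) : ℂ) by push_cast; ring, Complex.norm_cpow_real]

theorem norm_cpow_le_exp_mul {ν : ℂ} (hν : ν.re = -(1 / 2)) {w : ℂ} (hw : w ≠ 0) :
    ‖w ^ ν‖ ≤ Real.exp (Real.pi * |ν.im|) * ‖w‖ ^ (-(1 / 2) : ℝ) := by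
  rw [Complex.norm_cpow_of_ne_zero hw, hν, div_eq_mul_inv, ← Real.exp_neg, mul_comm]
  gcongr
  refine (neg_le_abs _).trans ?_
  rw [abs_mul]
  gcongr
  exact Complex.abs_arg_le_pi w

theorem norm_branchFun_le {a b : ℝ} {ν : ℂ} (hν : ν.re = -(1 / 2)) {w : ℂ} (hw : w ≠ 0) :
    ‖branchFun a b ν w‖ ≤ Real.exp (Real.pi * |ν.im|) *
      (‖w‖ ^ (-(1 / 2) : ℝ) * ‖w - a‖ ^ (-(1 / 2) : ℝ) * ‖w - b‖ ^ (-(1 / 2) : ℝ)) := by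
  rw [branchFun, norm_mul, norm_mul, norm_cpow_neg_one_half, norm_cpow_neg_one_half,
    ← mul_assoc, ← mul_assoc]
  gcongr
  exact norm_cpow_le_exp_mul hν hw

theorem norm_branchFun_le_tripleSing {a b : ℝ} {ν : ℂ} (hν : ν.re = -(1 / 2)) {w : ℂ}
    (h0 : w.re ≠ 0) (ha : w.re ≠ a) (hb : w.re ≠ b) :
    ‖branchFun a b ν w‖ ≤ Real.exp (Real.pi * |ν.im|) * tripleSing a b w.re := by
  have hw : w ≠ 0 := fun h => h0 (h ▸ Complex.zero_re)
  have hle (c : ℝ) (hc : w.re ≠ c) :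
      ‖w - c‖ ^ (-(1 / 2) : ℝ) ≤ |w.re - c| ^ (-(1 / 2) : ℝ) :=
    rpow_neg_half_le (abs_pos.2 (sub_ne_zero.2 hc)) (by simpa using Complex.abs_re_le_norm (w - c))
  refine (norm_branchFun_le hν hw).trans ?_
  rw [tripleSing]
  gcongr ?_ * (?_ * ?_ * ?_)
  · exact rpow_neg_half_le (abs_pos.2 h0) (Complex.abs_re_le_norm w)
  · exact hle a ha
  · exact hle b hb

theorem differentiableAt_branchFun {a b : ℝ} {ν w : ℂ} (hw : 0 < w.im) :
    DifferentiableAt ℂ (branchFun a b ν) w := by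
  have h (c : ℝ) : w - c ∈ Complex.slitPlane := Or.inr (by simpa using hw.ne')
  refine DifferentiableAt.mul (DifferentiableAt.mul ?_ ?_) ?_
  · exact differentiableAt_id.cpow_const (by simpa using h 0)
  · exact (differentiableAt_id.sub_const _).cpow_const (h a)
  · exact (differentiableAt_id.sub_const _).cpow_const (h b)

theorem continuousWithinAt_cpow_im_nonneg {w : ℂ} (hw : w ≠ 0) (ν : ℂ) :
    ContinuousWithinAt (fun w : ℂ => w ^ ν) {w : ℂ | 0 ≤ w.im} w := by
  by_cases h : w ∈ Complex.slitPlane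
  · exact (continuousAt_cpow_const h).continuousWithinAt
  · rw [Complex.mem_slitPlane_iff, not_or, not_lt, not_not] at h
    have hre : w.re < 0 := lt_of_le_of_ne h.1 fun h' => hw (Complex.ext h' h.2)
    have hlog := Complex.continuousWithinAt_log_of_re_neg_of_im_zero hre h.2
    have hexp : ContinuousWithinAt (fun w : ℂ => Complex.exp (Complex.log w * ν))
        {w : ℂ | 0 ≤ w.im} w := (hlog.mul continuousWithinAt_const).cexp
    refine hexp.congr_of_eventuallyEq ?_ (Complex.cpow_def_of_ne_zero hw _)
    filter_upwards [mem_nhdsWithin_of_mem_nhds (isOpen_ne.mem_nhds hw)] with v hv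
    exact Complex.cpow_def_of_ne_zero hv _

theorem tendsto_branchFun_nhdsGT {a b x : ℝ} (h0 : x ≠ 0) (ha : x ≠ a) (hb : x ≠ b) (ν : ℂ) :
    Tendsto (fun y : ℝ => branchFun a b ν (x + y * Complex.I)) (𝓝[>] 0)
      (𝓝 (branchFun a b ν x)) := by
  have h (c : ℝ) (hc : x ≠ c) (s : ℂ) :
      Tendsto (fun y : ℝ => ((x + y * Complex.I) - c : ℂ) ^ s) (𝓝[>] 0)
        (𝓝 ((x - c : ℂ) ^ s)) := by
    have hne : (x - c : ℂ) ≠ 0 := by exact_mod_cast sub_ne_zero.2 hc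
    have hcont : Continuous fun y : ℝ => ((x + y * Complex.I) - c : ℂ) := by fun_prop
    refine (continuousWithinAt_cpow_im_nonneg hne s).tendsto.comp
      (tendsto_nhdsWithin_iff.2 ⟨?_, ?_⟩)
    · exact (hcont.tendsto' 0 _ (by simp)).mono_left nhdsWithin_le_nhds
    · filter_upwards [self_mem_nhdsWithin] with y hy
      simpa using (le_of_lt hy : (0 : ℝ) ≤ y)
  simpa [branchFun] using ((h 0 h0 ν).mul (h a ha (-(1 / 2)))).mul (h b hb (-(1 / 2)))

theorem continuous_branchFun_line {a b : ℝ} {ν : ℂ} {y : ℝ} (hy : 0 < y) :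
    Continuous fun x : ℝ => branchFun a b ν (x + y * Complex.I) := by
  refine continuous_iff_continuousAt.2 fun x => ?_
  have h := (differentiableAt_branchFun (a := a) (b := b) (ν := ν)
    (w := x + y * Complex.I) (by simpa using hy)).continuousAt
  exact ContinuousAt.comp (f := fun x : ℝ => (x + y * Complex.I : ℂ)) h (by fun_prop)

theorem ae_norm_branchFun_line_le {a b : ℝ} {ν : ℂ} (hν : ν.re = -(1 / 2)) (y : ℝ) :
    ∀ᵐ x : ℝ, ‖branchFun a b ν (x + y * Complex.I)‖ ≤
      Real.exp (Real.pi * |ν.im|) * tripleSing a b x := by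
  filter_upwards [ae_ne_zero_and_ne_and_ne a b] with x ⟨hx0, hxa, hxb⟩
  simpa using norm_branchFun_le_tripleSing hν (w := x + y * Complex.I) (by simpa) (by simpa)
    (by simpa)

theorem integrable_branchFun_line {a b : ℝ} (h0 : 0 < a) (hab : a < b) {ν : ℂ}
    (hν : ν.re = -(1 / 2)) {y : ℝ} (hy : 0 < y) :
    Integrable fun x : ℝ => branchFun a b ν (x + y * Complex.I) :=
  ((integrable_tripleSing h0 hab).const_mul _).mono'
    (continuous_branchFun_line hy).aestronglyMeasurable (ae_norm_branchFun_line_le hν y)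

theorem integrable_branchFun {a b : ℝ} (h0 : 0 < a) (hab : a < b) {ν : ℂ}
    (hν : ν.re = -(1 / 2)) : Integrable fun x : ℝ => branchFun a b ν x := by
  refine ((integrable_tripleSing h0 hab).const_mul _).mono' (Measurable.aestronglyMeasurable ?_)
    (by simpa using ae_norm_branchFun_line_le hν 0)
  unfold branchFun
  exact ((Complex.measurable_ofReal.pow_const _).mul
    ((Complex.measurable_ofReal.sub_const _).pow_const _)).mul
    ((Complex.measurable_ofReal.sub_const _).pow_const _)

theorem tripleSing_le_of_le_abs {a b x : ℝ} (h0 : 0 < a) (hab : a < b) (hx : b + 1 ≤ |x|) :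
    tripleSing a b x ≤ |x| ^ (-(1 / 2) : ℝ) := by
  have hle (p : ℝ) (hp : 0 < p) (hpb : p ≤ b) : |x - p| ^ (-(1 / 2) : ℝ) ≤ 1 := by
    refine Real.rpow_le_one_of_one_le_of_nonpos ?_ (by norm_num)
    linarith [abs_sub_abs_le_abs_sub x p, abs_of_pos hp]
  rw [tripleSing, mul_assoc]
  exact mul_le_of_le_one_right (by positivity)
    (mul_le_one₀ (hle a h0 hab.le) (by positivity) (hle b (h0.trans hab) le_rfl))

theorem integral_branchFun_line_eq {a b : ℝ} (h0 : 0 < a) (hab : a < b) {ν : ℂ}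
    (hν : ν.re = -(1 / 2)) {c d : ℝ} (hc : 0 < c) (hcd : c ≤ d) :
    ∫ x : ℝ, branchFun a b ν (x + c * Complex.I) =
      ∫ x : ℝ, branchFun a b ν (x + d * Complex.I) := by
  have hdiff (z : ℂ) (hz : c ≤ z.im) : DifferentiableAt ℂ (branchFun a b ν) z :=
    differentiableAt_branchFun (hc.trans_le hz)
  have hlim : Tendsto (fun T : ℝ => Real.exp (Real.pi * |ν.im|) * T ^ (-(1 / 2) : ℝ)) atTop
      (𝓝 0) := by
    simpa using (tendsto_rpow_neg_atTop (y := 1 / 2) (by norm_num)).const_mul _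
  refine integral_horizontal_eq (R := b + 1) hcd
    (fun z hz => (hdiff z hz.1).continuousAt.continuousWithinAt)
    (fun z hz => (hdiff z hz.1.le).differentiableWithinAt) hlim (fun z _ hR => ?_)
    (integrable_branchFun_line h0 hab hν hc) (integrable_branchFun_line h0 hab hν (hc.trans_le hcd))
  have hne (p : ℝ) (hp : 0 ≤ p) (hpb : p ≤ b) : z.re ≠ p := by
    rintro h
    rw [h, abs_of_nonneg hp] at hR
    linarith
  refine (norm_branchFun_le_tripleSing hν (hne 0 le_rfl (h0.trans hab).le) (hne a h0.le hab.le)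
    (hne b (h0.trans hab).le le_rfl)).trans ?_
  gcongr
  exact tripleSing_le_of_le_abs h0 hab hR

theorem tendsto_integral_branchFun_line_nhdsGT {a b : ℝ} (h0 : 0 < a) (hab : a < b) {ν : ℂ}
    (hν : ν.re = -(1 / 2)) :
    Tendsto (fun y : ℝ => ∫ x : ℝ, branchFun a b ν (x + y * Complex.I)) (𝓝[>] 0)
      (𝓝 (∫ x : ℝ, branchFun a b ν x)) := by
  refine tendsto_integral_filter_of_dominated_convergence _ ?_
    (Eventually.of_forall (ae_norm_branchFun_line_le hν))
    ((integrable_tripleSing h0 hab).const_mul _) ?_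
  · filter_upwards [self_mem_nhdsWithin] with y hy
    exact (continuous_branchFun_line hy).aestronglyMeasurable
  · filter_upwards [ae_ne_zero_and_ne_and_ne a b] with x ⟨hx0, hxa, hxb⟩
    exact tendsto_branchFun_nhdsGT hx0 hxa hxb ν

theorem tendsto_branchFun_atTop {a b : ℝ} {ν : ℂ} (hν : ν.re = -(1 / 2)) {x : ℝ} (hxa : x ≠ a)
    (hxb : x ≠ b) :
    Tendsto (fun y : ℝ => branchFun a b ν (x + y * Complex.I)) atTop (𝓝 0) := by
  have hlim : Tendsto (fun y : ℝ => Real.exp (Real.pi * |ν.im|) * (y ^ (-(1 / 2) : ℝ) *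
      |x - a| ^ (-(1 / 2) : ℝ) * |x - b| ^ (-(1 / 2) : ℝ))) atTop (𝓝 0) := by
    simpa using (((tendsto_rpow_neg_atTop (y := 1 / 2) (by norm_num)).mul_const
      (|x - a| ^ (-(1 / 2) : ℝ))).mul_const (|x - b| ^ (-(1 / 2) : ℝ))).const_mul
      (Real.exp (Real.pi * |ν.im|))
  refine squeeze_zero_norm' ?_ hlim
  filter_upwards [eventually_gt_atTop 0] with y hy
  have hw : (x + y * Complex.I : ℂ) ≠ 0 := fun h => hy.ne' (by simpa using congrArg Complex.im h)
  have hle (c : ℝ) (hc : x ≠ c) :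
      ‖(x + y * Complex.I - c : ℂ)‖ ^ (-(1 / 2) : ℝ) ≤ |x - c| ^ (-(1 / 2) : ℝ) :=
    rpow_neg_half_le (abs_pos.2 (sub_ne_zero.2 hc))
      (by simpa using Complex.abs_re_le_norm (x + y * Complex.I - c))
  refine (norm_branchFun_le hν hw).trans ?_
  gcongr ?_ * (?_ * ?_ * ?_)
  · exact rpow_neg_half_le hy
      (by simpa [abs_of_pos hy] using Complex.abs_im_le_norm (x + y * Complex.I))
  · exact hle a hxa
  · exact hle b hxb

theorem tendsto_integral_branchFun_line_atTop {a b : ℝ} (h0 : 0 < a) (hab : a < b) {ν : ℂ}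
    (hν : ν.re = -(1 / 2)) :
    Tendsto (fun y : ℝ => ∫ x : ℝ, branchFun a b ν (x + y * Complex.I)) atTop (𝓝 0) := by
  rw [show (0 : ℂ) = ∫ _ : ℝ, (0 : ℂ) by simp]
  refine tendsto_integral_filter_of_dominated_convergence _ ?_
    (Eventually.of_forall (ae_norm_branchFun_line_le hν))
    ((integrable_tripleSing h0 hab).const_mul _) ?_
  · filter_upwards [eventually_gt_atTop 0] with y hy
    exact (continuous_branchFun_line hy).aestronglyMeasurable
  · filter_upwards [ae_ne_zero_and_ne_and_ne a b] with x ⟨_, hxa, hxb⟩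
    exact tendsto_branchFun_atTop hν hxa hxb

theorem integral_branchFun_eq_zero {a b : ℝ} (h0 : 0 < a) (hab : a < b) {ν : ℂ}
    (hν : ν.re = -(1 / 2)) : ∫ x : ℝ, branchFun a b ν x = 0 := by
  have hline (y : ℝ) (hy : 0 < y) : ∫ x : ℝ, branchFun a b ν (x + y * Complex.I) = 0 := by
    refine tendsto_nhds_unique (tendsto_const_nhds.congr' ?_)
      (tendsto_integral_branchFun_line_atTop h0 hab hν)
    filter_upwards [eventually_ge_atTop y] with d hd
    exact integral_branchFun_line_eq h0 hab hν hy hd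
  refine tendsto_nhds_unique (tendsto_integral_branchFun_line_nhdsGT h0 hab hν)
    (tendsto_const_nhds.congr' ?_)
  filter_upwards [self_mem_nhdsWithin] with y hy
  exact (hline y hy).symm

/-! ### The connection formula between `P` and `Q` -/

theorem cpow_neg_one_half_of_neg {r : ℝ} (hr : r < 0) :
    (r : ℂ) ^ (-(1 / 2) : ℂ) = -Complex.I * (√(-r) : ℂ)⁻¹ := by
  have hexp : Complex.exp (Real.pi * Complex.I * (-(1 / 2))) = -Complex.I := by
    rw [show (Real.pi * Complex.I * (-(1 / 2)) : ℂ) = -(Real.pi / 2 * Complex.I) by ring,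
      Complex.exp_neg, Complex.exp_pi_div_two_mul_I, Complex.inv_I]
  rw [Complex.ofReal_cpow_of_nonpos hr.le, hexp, ← Complex.ofReal_neg,
    cpow_neg_one_half (by linarith)]
  ring

/-- The integral of `x ^ ν r(x)` over `S`. The pieces of `∫ branchFun a b ν` between the branch
points are of this form, up to a unit, with `r` real. -/
def powIntegral (S : Set ℝ) (r : ℝ → ℝ) (ν : ℂ) : ℂ :=
  ∫ x in S, (x : ℂ) ^ ν * ((r x : ℝ) : ℂ)

theorem conj_powIntegral {S : Set ℝ} (hS : MeasurableSet S) (hpos : S ⊆ Set.Ioi 0) (r : ℝ → ℝ)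
    (ν : ℂ) : starRingEnd ℂ (powIntegral S r (starRingEnd ℂ ν)) = powIntegral S r ν := by
  rw [powIntegral, ← integral_conj, powIntegral]
  refine setIntegral_congr_fun hS fun x hx => ?_
  have hx0 : 0 < x := hpos hx
  have harg : (x : ℂ).arg ≠ Real.pi := by
    rw [Complex.arg_ofReal_of_nonneg hx0.le]
    exact Real.pi_pos.ne
  simp only [map_mul, Complex.conj_ofReal]
  rw [Complex.cpow_conj _ _ harg, Complex.conj_ofReal]
  simp

section branchFun

variable {a b x : ℝ}

theorem branchFun_of_gt (hab : a ≤ b) (hx : b < x) (ν : ℂ) :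
    branchFun a b ν x = (x : ℂ) ^ ν * ((√((x - a) * (x - b)))⁻¹ : ℝ) := by
  rw [branchFun, ← Complex.ofReal_sub, ← Complex.ofReal_sub, cpow_neg_one_half (by linarith),
    cpow_neg_one_half (by linarith), Real.sqrt_mul (by linarith)]
  push_cast
  rw [mul_inv]
  ring

theorem branchFun_of_mem_Ioo (hx : x ∈ Set.Ioo a b) (ν : ℂ) :
    branchFun a b ν x =
      -Complex.I * ((x : ℂ) ^ ν * ((√((x - a) * (b - x)))⁻¹ : ℝ)) := by
  have ha : 0 ≤ x - a := by linarith [hx.1]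
  rw [branchFun, ← Complex.ofReal_sub, ← Complex.ofReal_sub, cpow_neg_one_half ha,
    cpow_neg_one_half_of_neg (by linarith [hx.2]), Real.sqrt_mul ha, neg_sub]
  push_cast
  rw [mul_inv]
  ring

theorem branchFun_of_lt (hab : a ≤ b) (hx : x < a) (ν : ℂ) :
    branchFun a b ν x = -((x : ℂ) ^ ν * ((√((a - x) * (b - x)))⁻¹ : ℝ)) := by
  rw [branchFun, ← Complex.ofReal_sub, ← Complex.ofReal_sub,
    cpow_neg_one_half_of_neg (by linarith), cpow_neg_one_half_of_neg (by linarith),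
    Real.sqrt_mul (by linarith), neg_sub, neg_sub]
  push_cast
  rw [mul_inv]
  linear_combination ((x : ℂ) ^ ν * (√(a - x) : ℂ)⁻¹ * (√(b - x) : ℂ)⁻¹) * Complex.I_sq

theorem branchFun_neg (h0 : 0 < a) (hab : a ≤ b) (hx : 0 < x) (ν : ℂ) :
    branchFun a b ν (-x : ℝ) = -(Complex.exp (Real.pi * Complex.I * ν) *
      ((x : ℂ) ^ ν * ((√((x + a) * (x + b)))⁻¹ : ℝ))) := by
  rw [branchFun_of_lt hab (by linarith), Complex.ofReal_cpow_of_nonpos (by linarith),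
    sub_neg_eq_add, sub_neg_eq_add, add_comm a, add_comm b, ← Complex.ofReal_neg, neg_neg]
  ring

theorem integral_eq_add_of_lt_of_lt {f : ℝ → ℂ} (hf : Integrable f) (h0 : 0 < a) (hab : a < b) :
    ∫ x, f x = (∫ x in Set.Ioi 0, f (-x)) + (∫ x in Set.Ioo 0 a, f x) +
      (∫ x in Set.Ioo a b, f x) + ∫ x in Set.Ioi b, f x := by
  rw [← intervalIntegral.integral_Iic_add_Ioi (b := 0) hf.integrableOn hf.integrableOn,
    integral_comp_neg_Ioi, neg_zero, ← Set.Ioc_union_Ioi_eq_Ioi h0.le,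
    setIntegral_union (Set.Ioc_disjoint_Ioi le_rfl) measurableSet_Ioi hf.integrableOn
      hf.integrableOn, ← Set.Ioc_union_Ioi_eq_Ioi hab.le,
    setIntegral_union (Set.Ioc_disjoint_Ioi le_rfl) measurableSet_Ioi hf.integrableOn
      hf.integrableOn, integral_Ioc_eq_integral_Ioo, integral_Ioc_eq_integral_Ioo]
  ring

theorem powIntegral_relation (h0 : 0 < a) (hab : a < b) {ν : ℂ} (hν : ν.re = -(1 / 2)) :
    powIntegral (Set.Ioi b) (fun x => (√((x - a) * (x - b)))⁻¹) ν -
      Complex.I * powIntegral (Set.Ioo a b) (fun x => (√((x - a) * (b - x)))⁻¹) ν -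
      powIntegral (Set.Ioo 0 a) (fun x => (√((a - x) * (b - x)))⁻¹) ν -
      Complex.exp (Real.pi * Complex.I * ν) *
        powIntegral (Set.Ioi 0) (fun x => (√((x + a) * (x + b)))⁻¹) ν = 0 := by
  rw [← integral_branchFun_eq_zero h0 hab hν,
    integral_eq_add_of_lt_of_lt (integrable_branchFun h0 hab hν) h0 hab,
    setIntegral_congr_fun measurableSet_Ioi fun x hx => branchFun_neg h0 hab.le hx ν,
    setIntegral_congr_fun measurableSet_Ioo fun x hx => branchFun_of_lt hab.le hx.2 ν,
    setIntegral_congr_fun measurableSet_Ioo fun x hx => branchFun_of_mem_Ioo hx ν,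
    setIntegral_congr_fun measurableSet_Ioi fun x hx => branchFun_of_gt hab.le hx ν,
    integral_neg, integral_neg, integral_const_mul, integral_const_mul]
  simp only [powIntegral]
  ring

end branchFun

theorem image_inv_Ioo_zero {a : ℝ} (h0 : 0 < a) :
    (fun x : ℝ => x⁻¹) '' Set.Ioo 0 a = Set.Ioi a⁻¹ := by
  rw [Set.image_inv_eq_inv, Set.inv_Ioo_0_left h0]

theorem powIntegral_Ioi_eq_legendreQ {a : ℝ} (h0 : 0 < a) (h1 : a < 1) (ν : ℂ) :
    powIntegral (Set.Ioi a⁻¹) (fun x => (√((x - a) * (x - a⁻¹)))⁻¹) ν = legendreQ a (-ν) := by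
  rw [powIntegral, legendreQ, ← image_inv_Ioo_zero h0,
    integral_image_eq_integral_abs_deriv_smul measurableSet_Ioo
      (fun x hx => (hasDerivAt_inv hx.1.ne').hasDerivWithinAt) inv_injective.injOn]
  refine setIntegral_congr_fun measurableSet_Ioo fun x hx => ?_
  have hx0 := hx.1
  have hxc : (x : ℂ) ≠ 0 := by exact_mod_cast hx0.ne'
  have hinv : 1 < a⁻¹ := (one_lt_inv₀ h0).2 h1
  have harg : (x : ℂ).arg ≠ Real.pi := by
    rw [Complex.arg_ofReal_of_nonneg hx0.le]
    exact Real.pi_pos.ne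
  have hsqrt : √((x⁻¹ - a) * (x⁻¹ - a⁻¹)) = √((a - x) * (a⁻¹ - x)) / x := by
    rw [show (x⁻¹ - a) * (x⁻¹ - a⁻¹) = (a - x) * (a⁻¹ - x) / x ^ 2 by field_simp,
      Real.sqrt_div (mul_nonneg (by linarith [hx.2]) (by linarith [hx.2])), Real.sqrt_sq hx0.le]
  rw [hsqrt, abs_neg, abs_of_pos (by positivity), Complex.real_smul, Complex.ofReal_inv x,
    Complex.inv_cpow _ _ harg, Complex.cpow_sub _ _ hxc, Complex.cpow_neg, Complex.cpow_one]
  push_cast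
  field_simp

theorem powIntegral_Ioo_eq_legendreQ (a : ℝ) (ν : ℂ) :
    powIntegral (Set.Ioo 0 a) (fun x => (√((a - x) * (a⁻¹ - x)))⁻¹) ν = legendreQ a (ν + 1) := by
  simp [powIntegral, legendreQ, div_eq_mul_inv]

theorem image_cos_Ioo_zero_pi : Real.cos '' Set.Ioo 0 Real.pi = Set.Ioo (-1) 1 := by
  refine Set.Subset.antisymm ?_ fun y hy => ?_
  · rintro _ ⟨φ, hφ, rfl⟩
    have hsin := Real.sin_pos_of_mem_Ioo hφ
    have hsq := Real.sin_sq_add_cos_sq φ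
    constructor <;> nlinarith
  · refine ⟨Real.arccos y, ⟨Real.arccos_pos.2 hy.2, ?_⟩, Real.cos_arccos hy.1.le hy.2.le⟩
    exact (Real.arccos_le_pi y).lt_of_ne fun h => hy.1.not_ge (Real.arccos_eq_pi.1 h)

theorem image_add_mul_cos (c : ℝ) {ρ : ℝ} (hρ : 0 < ρ) :
    (fun φ : ℝ => c + ρ * Real.cos φ) '' Set.Ioo 0 Real.pi = Set.Ioo (c - ρ) (c + ρ) := by
  rw [← Set.image_image (fun y => c + ρ * y), image_cos_Ioo_zero_pi,
    ← Set.image_image (c + ·) (ρ * ·), Set.image_mul_left_Ioo hρ, Set.image_const_add_Ioo]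
  simp [sub_eq_add_neg]

theorem injOn_add_mul_cos (c : ℝ) {ρ : ℝ} (hρ : ρ ≠ 0) :
    Set.InjOn (fun φ : ℝ => c + ρ * Real.cos φ) (Set.Ioo 0 Real.pi) := fun _ hφ _ hψ h =>
  Real.injOn_cos (Set.Ioo_subset_Icc_self hφ) (Set.Ioo_subset_Icc_self hψ)
    (mul_left_cancel₀ hρ (add_left_cancel h))

theorem sqrt_joukowski_sq_sub_one {a : ℝ} (h0 : 0 < a) (h1 : a < 1) :
    √(joukowski a ^ 2 - 1) = (a⁻¹ - a) / 2 := by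
  have hinv : 1 < a⁻¹ := (one_lt_inv₀ h0).2 h1
  rw [← Real.sqrt_sq (show 0 ≤ (a⁻¹ - a) / 2 by linarith)]
  congr 1
  rw [joukowski]
  field_simp
  ring

theorem powIntegral_Ioo_eq_legendreP {a : ℝ} (h0 : 0 < a) (h1 : a < 1) (ν : ℂ) :
    powIntegral (Set.Ioo a a⁻¹) (fun x => (√((x - a) * (a⁻¹ - x)))⁻¹) ν =
      Real.pi * legendreP ν (joukowski a) := by
  have hpi : (Real.pi : ℂ) ≠ 0 := by exact_mod_cast Real.pi_ne_zero
  rw [legendreP, ← mul_assoc, mul_inv_cancel₀ hpi, one_mul, sqrt_joukowski_sq_sub_one h0 h1,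
    intervalIntegral.integral_of_le Real.pi_pos.le, integral_Ioc_eq_integral_Ioo]
  set ρ := (a⁻¹ - a) / 2 with hρ
  have hρ0 : 0 < ρ := by linarith [(one_lt_inv₀ h0).2 h1]
  have hJa : a = joukowski a - ρ := by rw [joukowski, hρ]; ring
  have hJb : a⁻¹ = joukowski a + ρ := by rw [joukowski, hρ]; ring
  have himg := image_add_mul_cos (joukowski a) hρ0
  rw [← hJa, ← hJb] at himg
  rw [powIntegral, ← himg, integral_image_eq_integral_abs_deriv_smul measurableSet_Ioo
    (fun φ _ => (((Real.hasDerivAt_cos φ).const_mul ρ).const_add _).hasDerivWithinAt)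
    (injOn_add_mul_cos _ hρ0.ne')]
  refine setIntegral_congr_fun measurableSet_Ioo fun φ hφ => ?_
  have hsin := Real.sin_pos_of_mem_Ioo hφ
  have hprod : (joukowski a + ρ * Real.cos φ - a) * (a⁻¹ - (joukowski a + ρ * Real.cos φ)) =
      (ρ * Real.sin φ) ^ 2 := by
    rw [hJb]
    nth_rewrite 2 [hJa]
    linear_combination (-ρ ^ 2) * Real.sin_sq_add_cos_sq φ
  rw [hprod, Real.sqrt_sq (by positivity), mul_neg, abs_neg, abs_of_pos (by positivity),
    Complex.real_smul, mul_left_comm, ← Complex.ofReal_mul, mul_inv_cancel₀ (by positivity),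
    Complex.ofReal_one, mul_one]

section connection

variable {a : ℝ} (h0 : 0 < a) (h1 : a < 1)
include h0 h1

theorem legendre_relation {ν : ℂ} (hν : ν.re = -(1 / 2)) :
    legendreQ a (-ν) - Complex.I * (Real.pi * legendreP ν (joukowski a)) - legendreQ a (ν + 1) -
      Complex.exp (Real.pi * Complex.I * ν) *
        powIntegral (Set.Ioi 0) (fun x => (√((x + a) * (x + a⁻¹)))⁻¹) ν = 0 := by
  rw [← powIntegral_Ioi_eq_legendreQ h0 h1, ← powIntegral_Ioo_eq_legendreQ,
    ← powIntegral_Ioo_eq_legendreP h0 h1]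
  exact powIntegral_relation h0 (h1.trans ((one_lt_inv₀ h0).2 h1)) hν

theorem legendre_relation_conj {ν : ℂ} (hν : ν.re = -(1 / 2)) :
    legendreQ a (-ν) + Complex.I * (Real.pi * legendreP ν (joukowski a)) - legendreQ a (ν + 1) -
      Complex.exp (-(Real.pi * Complex.I * ν)) *
        powIntegral (Set.Ioi 0) (fun x => (√((x + a) * (x + a⁻¹)))⁻¹) ν = 0 := by
  have hinv : 1 < a⁻¹ := (one_lt_inv₀ h0).2 h1
  have h_conj := congrArg (starRingEnd ℂ) (powIntegral_relation h0 (h1.trans hinv)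
    (ν := starRingEnd ℂ ν) (by simpa using hν))
  simp only [map_sub, map_mul, map_zero, Complex.conj_I, ← Complex.exp_conj, Complex.conj_ofReal,
    Complex.conj_conj] at h_conj
  rw [conj_powIntegral measurableSet_Ioi (Set.Ioi_subset_Ioi (by linarith)),
    conj_powIntegral measurableSet_Ioo fun x hx => h0.trans hx.1,
    conj_powIntegral measurableSet_Ioo fun x hx => hx.1,
    conj_powIntegral measurableSet_Ioi subset_rfl, powIntegral_Ioi_eq_legendreQ h0 h1,
    powIntegral_Ioo_eq_legendreQ, powIntegral_Ioo_eq_legendreP h0 h1, mul_neg, neg_mul, neg_mul,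
    sub_neg_eq_add] at h_conj
  exact h_conj

theorem legendreQ_sub_legendreQ (t : ℝ) :
    legendreQ a (1 / 2 - Complex.I * t) - legendreQ a (1 / 2 + Complex.I * t) =
      Complex.I * Real.pi * Real.tanh (Real.pi * t) *
        legendreP (-1 / 2 + Complex.I * t) (joukowski a) := by
  set ν : ℂ := -1 / 2 + Complex.I * t with hν
  have hre : ν.re = -(1 / 2) := by simp [hν]; norm_num
  have h_rel := legendre_relation h0 h1 hre
  have h_conj := legendre_relation_conj h0 h1 hre
  have hexp : Complex.exp (Real.pi * Complex.I * ν) =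
      -Complex.I * Complex.exp (-(Real.pi * t)) := by
    rw [show (Real.pi * Complex.I * ν : ℂ) = -(Real.pi / 2 * Complex.I) + -(Real.pi * t) by
      rw [hν]; linear_combination (Real.pi * t : ℂ) * Complex.I_sq, Complex.exp_add,
      Complex.exp_neg, Complex.exp_pi_div_two_mul_I, Complex.inv_I]
  rw [Complex.exp_neg, hexp, mul_inv, ← Complex.exp_neg, neg_neg, inv_neg, Complex.inv_I,
    neg_neg] at h_conj
  rw [hexp] at h_rel
  rw [show (1 / 2 - Complex.I * t : ℂ) = -ν by rw [hν]; ring,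
    show (1 / 2 + Complex.I * t : ℂ) = ν + 1 by rw [hν]; ring]
  have hcosh : Complex.cosh (Real.pi * t) ≠ 0 := by
    exact_mod_cast (Real.cosh_pos (Real.pi * t)).ne'
  rw [Complex.ofReal_tanh, Complex.ofReal_mul, Complex.tanh_eq_sinh_div_cosh, ← mul_div_assoc,
    div_mul_eq_mul_div, eq_div_iff hcosh, Complex.cosh, Complex.sinh]
  linear_combination (Complex.exp (Real.pi * t) / 2) * h_rel +
    (Complex.exp (-(Real.pi * t)) / 2) * h_conj

end connection

/-! ### The spectral integral attached to one group element -/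

theorem isClosed_strip (δ : ℝ) : IsClosed (strip δ) :=
  isClosed_le (continuous_abs.comp Complex.continuous_im) continuous_const

theorem strip_mono {δ ε : ℝ} (h : δ ≤ ε) : strip δ ⊆ strip ε := fun r (hr : |r.im| ≤ 1 / 2 + δ) =>
  show |r.im| ≤ 1 / 2 + ε by linarith

theorem ofReal_mem_strip {δ : ℝ} (hδ : 0 ≤ δ) (r : ℝ) : (r : ℂ) ∈ strip δ :=
  show |(r : ℂ).im| ≤ 1 / 2 + δ by
    rw [Complex.ofReal_im, abs_zero]
    positivity

theorem mem_strip_of_im_mem_Icc {δ : ℝ} {r : ℂ} (hr : r.im ∈ Set.Icc (-(1 / 2 + δ)) 0) :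
    r ∈ strip δ :=
  abs_le.2 ⟨hr.1, by linarith [hr.1, hr.2]⟩

theorem exists_norm_le_of_isBigO_strip {h : ℂ → ℂ} {δ : ℝ} (hc : ContinuousOn h (strip δ))
    (hO : h =O[Bornology.cobounded ℂ ⊓ 𝓟 (strip δ)] fun r : ℂ => (1 + ‖r‖) ^ (-2 : ℤ)) :
    ∃ C, 0 ≤ C ∧ ∀ r ∈ strip δ, ‖h r‖ ≤ C * (1 + ‖r‖) ^ (-2 : ℤ) := by
  obtain ⟨c, hc0, hbound⟩ := hO.exists_nonneg
  rw [Asymptotics.IsBigOWith, eventually_inf_principal] at hbound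
  obtain ⟨R, -, hR⟩ :=
    (Metric.hasBasis_cobounded_compl_closedBall (0 : ℂ)).eventually_iff.1 hbound
  obtain ⟨M, hM⟩ := ((isCompact_closedBall 0 R).inter_left
    (isClosed_strip δ)).exists_bound_of_continuousOn (hc.mono Set.inter_subset_left)
  refine ⟨c + |M| * (1 + |R|) ^ 2, by positivity, fun r hr => ?_⟩
  rw [add_mul]
  by_cases hrR : r ∈ Metric.closedBall 0 R
  · have hr_le : ‖r‖ ≤ |R| := (mem_closedBall_zero_iff.1 hrR).trans (le_abs_self R)
    have hone : 1 ≤ (1 + |R|) ^ 2 * (1 + ‖r‖) ^ (-2 : ℤ) := by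
      rw [zpow_neg, ← div_eq_mul_inv, one_le_div (by positivity)]
      norm_cast
      gcongr
    calc ‖h r‖ ≤ |M| := (hM r ⟨hr, hrR⟩).trans (le_abs_self M)
      _ ≤ |M| * ((1 + |R|) ^ 2 * (1 + ‖r‖) ^ (-2 : ℤ)) := le_mul_of_one_le_right (abs_nonneg M) hone
      _ ≤ _ := by
        rw [← mul_assoc]
        exact le_add_of_nonneg_left (by positivity)
  · have h_far := hR hrR hr
    rw [Real.norm_of_nonneg (by positivity)] at h_far
    exact h_far.trans (le_add_of_nonneg_right (by positivity))

/-- The function `r h(r) Q_{-1/2+ir}(cosh d)`, where `a = e^{-d}`. -/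
def spectralFun (h : ℂ → ℂ) (a : ℝ) (r : ℂ) : ℂ :=
  r * h r * legendreQ a (1 / 2 + Complex.I * r)

theorem re_one_half_add_I_mul (r : ℂ) : (1 / 2 + Complex.I * r).re = 1 / 2 - r.im := by
  simp only [Complex.add_re, Complex.I_mul_re]
  norm_num
  ring

theorem inv_sqrt_norm_one_half_add_I_mul_le {r : ℂ} (hr : r.im ≤ 0) :
    (√‖1 / 2 + Complex.I * r‖)⁻¹ ≤ 2 * (1 + ‖r‖) ^ (-(1 / 2) : ℝ) := by
  have h_half : 1 / 2 ≤ ‖1 / 2 + Complex.I * r‖ := by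
    refine le_trans ?_ (Complex.re_le_norm _)
    rw [re_one_half_add_I_mul]
    linarith
  have h_norm : ‖r‖ ≤ ‖1 / 2 + Complex.I * r‖ + 1 / 2 := by
    calc ‖r‖ = ‖1 / 2 + Complex.I * r - 1 / 2‖ := by rw [add_sub_cancel_left]; simp
      _ ≤ ‖1 / 2 + Complex.I * r‖ + ‖(1 / 2 : ℂ)‖ := norm_sub_le _ _
      _ = _ := by norm_num
  rw [Real.rpow_neg (by positivity), ← Real.sqrt_eq_rpow, ← div_eq_mul_inv,
    inv_le_comm₀ (by positivity) (by positivity), inv_div, div_le_iff₀ two_pos]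
  calc √(1 + ‖r‖) ≤ √(‖1 / 2 + Complex.I * r‖ * 2 ^ 2) := Real.sqrt_le_sqrt (by linarith)
    _ = √‖1 / 2 + Complex.I * r‖ * 2 := by
      rw [Real.sqrt_mul (norm_nonneg _), Real.sqrt_sq two_pos.le]

theorem mul_zpow_neg_two_mul_rpow_neg_half {x : ℝ} (hx : 0 < x) :
    x * x ^ (-2 : ℤ) * x ^ (-(1 / 2) : ℝ) = x ^ (-(3 / 2) : ℝ) := by
  rw [← zpow_one_add₀ hx.ne', ← Real.rpow_intCast, ← Real.rpow_add hx]
  norm_num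

theorem integrable_one_add_abs_rpow : Integrable fun x : ℝ => (1 + |x|) ^ (-(3 / 2) : ℝ) := by
  simpa using integrable_one_add_norm (E := ℝ) (μ := volume) (r := 3 / 2) (by norm_num)

theorem spectralFun_add_spectralFun_neg {h : ℂ → ℂ} {a : ℝ} (h0 : 0 < a) (h1 : a < 1) {r : ℝ}
    (heven : h (-r) = h r) :
    (r * Real.tanh (Real.pi * r) : ℂ) * h r * legendreP (-1 / 2 + Complex.I * r) (joukowski a) =
      Complex.I / Real.pi * (spectralFun h a r + spectralFun h a ((-r : ℝ) : ℂ)) := by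
  have h_tanh : (Real.tanh (Real.pi * r) : ℂ) *
      legendreP (-1 / 2 + Complex.I * r) (joukowski a) = -(Complex.I / Real.pi) *
        (legendreQ a (1 / 2 - Complex.I * r) - legendreQ a (1 / 2 + Complex.I * r)) := by
    have hpi : (Real.pi : ℂ) ≠ 0 := by exact_mod_cast Real.pi_ne_zero
    rw [legendreQ_sub_legendreQ h0 h1, mul_assoc, mul_assoc, ← mul_assoc (-_)]
    field_simp
    rw [Complex.I_sq]
    ring
  rw [spectralFun, spectralFun, Complex.ofReal_neg, heven, mul_neg, ← sub_eq_add_neg]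
  linear_combination ((r : ℂ) * h r) * h_tanh

section spectralFun

variable {h : ℂ → ℂ} {a δ : ℝ}

theorem differentiableOn_spectralFun (hd : DifferentiableOn ℂ h (strip δ)) (h0 : 0 < a)
    (h1 : a < 1) :
    DifferentiableOn ℂ (spectralFun h a) {r | r.im ∈ Set.Icc (-(1 / 2 + δ)) 0} := by
  refine (differentiableOn_id.mul (hd.mono fun r hr => mem_strip_of_im_mem_Icc hr)).mul
    fun r hr => DifferentiableAt.differentiableWithinAt ?_
  have hre : 0 < (1 / 2 + Complex.I * r).re := by
    rw [re_one_half_add_I_mul]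
    linarith [hr.2]
  exact DifferentiableAt.comp (g := legendreQ a) r (differentiableAt_legendreQ h0 h1 hre)
    (by fun_prop)

theorem continuous_spectralFun_line (hd : DifferentiableOn ℂ h (strip δ)) (h0 : 0 < a)
    (h1 : a < 1) {y : ℝ} (hy : y ∈ Set.Icc (-(1 / 2 + δ)) 0) :
    Continuous fun x : ℝ => spectralFun h a (x + y * Complex.I) :=
  (differentiableOn_spectralFun hd h0 h1).continuousOn.comp_continuous (by fun_prop)
    fun x => by simpa using hy

variable (hd : DifferentiableOn ℂ h (strip δ))
  (hO : h =O[Bornology.cobounded ℂ ⊓ 𝓟 (strip δ)] fun r : ℂ => (1 + ‖r‖) ^ (-2 : ℤ))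
include hd hO

theorem exists_norm_spectralFun_le {a₀ : ℝ} (ha₀ : a₀ < 1) :
    ∃ C, 0 ≤ C ∧ ∀ a, 0 < a → a ≤ a₀ → ∀ r : ℂ, r.im ∈ Set.Icc (-(1 / 2 + δ)) 0 →
      ‖spectralFun h a r‖ ≤ C * a ^ (1 / 2 - r.im) * (1 + |r.re|) ^ (-(3 / 2) : ℝ) := by
  obtain ⟨C, hC0, hC⟩ := exists_norm_le_of_isBigO_strip hd.continuousOn hO
  obtain ⟨D, hD0, hD⟩ := exists_norm_legendreQ_le (σ := 1 / 2) (by norm_num) ha₀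
  refine ⟨2 * C * D, by positivity, fun a h0 ha r hr => ?_⟩
  have hQ := hD a h0 ha (1 / 2 + Complex.I * r) (by rw [re_one_half_add_I_mul]; linarith [hr.2])
  rw [re_one_half_add_I_mul, div_eq_mul_inv] at hQ
  have hh := hC r (mem_strip_of_im_mem_Icc hr)
  have h_sqrt := inv_sqrt_norm_one_half_add_I_mul_le hr.2
  have h_re : (1 + ‖r‖) ^ (-(3 / 2) : ℝ) ≤ (1 + |r.re|) ^ (-(3 / 2) : ℝ) :=
    Real.rpow_le_rpow_of_nonpos (by positivity) (by linarith [Complex.abs_re_le_norm r])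
      (by norm_num)
  rw [spectralFun, norm_mul, norm_mul]
  calc ‖r‖ * ‖h r‖ * ‖legendreQ a (1 / 2 + Complex.I * r)‖
      ≤ (1 + ‖r‖) * (C * (1 + ‖r‖) ^ (-2 : ℤ)) *
        (D * a ^ (1 / 2 - r.im) * (2 * (1 + ‖r‖) ^ (-(1 / 2) : ℝ))) := by
        gcongr
        · linarith
        · exact hQ.trans (mul_le_mul_of_nonneg_left h_sqrt (by positivity))
    _ = 2 * C * D * a ^ (1 / 2 - r.im) *
        ((1 + ‖r‖) * (1 + ‖r‖) ^ (-2 : ℤ) * (1 + ‖r‖) ^ (-(1 / 2) : ℝ)) := by ring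
    _ ≤ _ := by
        rw [mul_zpow_neg_two_mul_rpow_neg_half (by positivity)]
        gcongr

theorem integrable_spectralFun_line (h0 : 0 < a) (h1 : a < 1) {y : ℝ}
    (hy : y ∈ Set.Icc (-(1 / 2 + δ)) 0) :
    Integrable fun x : ℝ => spectralFun h a (x + y * Complex.I) := by
  obtain ⟨C, -, hC⟩ := exists_norm_spectralFun_le hd hO h1
  refine (integrable_one_add_abs_rpow.const_mul (C * a ^ (1 / 2 - y))).mono'
    (continuous_spectralFun_line hd h0 h1 hy).aestronglyMeasurable
    (Eventually.of_forall fun x => ?_)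
  simpa using hC a h0 le_rfl (x + y * Complex.I) (by simpa using hy)

theorem integral_spectralFun_shift (hδ : 0 ≤ δ) (h0 : 0 < a) (h1 : a < 1) :
    ∫ x : ℝ, spectralFun h a (x + (-(1 / 2 + δ) : ℝ) * Complex.I) =
      ∫ x : ℝ, spectralFun h a x := by
  have hle : -(1 / 2 + δ) ≤ 0 := by linarith
  obtain ⟨C, hC0, hC⟩ := exists_norm_spectralFun_le hd hO h1
  have hdiff := differentiableOn_spectralFun hd h0 h1
  have hlim : Tendsto (fun T : ℝ => C * (1 + T) ^ (-(3 / 2) : ℝ)) atTop (𝓝 0) := by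
    simpa using ((tendsto_rpow_neg_atTop (y := 3 / 2) (by norm_num)).comp
      (tendsto_atTop_add_const_left _ (1 : ℝ) tendsto_id)).const_mul C
  have h_shift := integral_horizontal_eq (R := 0) hle hdiff.continuousOn
    (hdiff.mono fun r hr => ⟨hr.1.le, hr.2.le⟩) hlim (fun r hr _ => ?_)
    (integrable_spectralFun_line hd hO h0 h1 ⟨le_rfl, hle⟩)
    (integrable_spectralFun_line hd hO h0 h1 ⟨hle, le_rfl⟩)
  · simpa using h_shift
  · refine (hC a h0 le_rfl r hr).trans ?_
    gcongr
    exact mul_le_of_le_one_right hC0 (Real.rpow_le_one h0.le h1.le (by linarith [hr.2]))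

theorem integral_legendreP_eq (heven : ∀ r : ℝ, h (-r) = h r) (hδ : 0 ≤ δ) (h0 : 0 < a)
    (h1 : a < 1) :
    ∫ r : ℝ, (r * Real.tanh (Real.pi * r) : ℂ) * h r *
        legendreP (-1 / 2 + Complex.I * r) (joukowski a) =
      2 * Complex.I / Real.pi *
        ∫ x : ℝ, spectralFun h a (x + (-(1 / 2 + δ) : ℝ) * Complex.I) := by
  have h_int : Integrable fun x : ℝ => spectralFun h a x := by
    simpa using integrable_spectralFun_line hd hO h0 h1 (y := 0) ⟨by linarith, le_rfl⟩
  simp_rw [fun r => spectralFun_add_spectralFun_neg h0 h1 (heven r)]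
  rw [integral_const_mul, integral_add h_int h_int.comp_neg,
    integral_neg_eq_self (fun x : ℝ => spectralFun h a x),
    integral_spectralFun_shift hd hO hδ h0 h1]
  ring

end spectralFun

/-! ### Summation over the group -/

theorem exists_lt_forall_le_of_tendsto_cofinite {ι : Type*} {f : ι → ℝ} {c b : ℝ} (hcb : c < b)
    (hf : Tendsto f cofinite (𝓝 c)) (hlt : ∀ i, f i < b) : ∃ a < b, ∀ i, f i ≤ a := by
  obtain ⟨m, hcm, hmb⟩ := exists_between hcb
  have h_large : {i | ¬ f i < m}.Finite := hf.eventually_lt_const hcm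
  have h_bound : ∀ᶠ a in 𝓝[<] b, ∀ i ∈ {i | ¬ f i < m}, f i < a :=
    (eventually_all_finite h_large).2 fun i _ =>
      mem_of_superset (Ioo_mem_nhdsLT (hlt i)) fun a ha => ha.1
  obtain ⟨a, ha, hma, hab⟩ := (h_bound.and (Ioo_mem_nhdsLT hmb)).exists
  refine ⟨a, hab, fun i => ?_⟩
  by_cases hi : f i < m
  · exact (hi.trans hma).le
  · exact (ha i hi).le

section tsum

variable {α ι : Type*} [MeasurableSpace α] {m : Measure α} [Countable ι] {F : ι → α → ℂ}
  {B : ι → ℝ} {g : α → ℝ} (hF : ∀ i, AEStronglyMeasurable (F i) m) (hB : Summable B)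
  (hg : Integrable g m) (hFB : ∀ i x, ‖F i x‖ ≤ B i * g x)
include hF hB hg hFB

theorem integrable_tsum_of_norm_le_mul : Integrable (fun x => ∑' i, F i x) m := by
  have hbound (x : α) : ‖∑' i, F i x‖ ≤ (∑' i, B i) * g x :=
    tsum_of_norm_bounded (hB.hasSum.mul_right _) fun i => hFB i x
  refine (hg.const_mul (∑' i, B i)).mono' ?_ (Eventually.of_forall hbound)
  refine aestronglyMeasurable_of_tendsto_ae atTop
    (f := fun (s : Finset ι) x => ∑ i ∈ s, F i x) (fun s => ?_) (Eventually.of_forall fun x => ?_)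
  · exact Finset.aestronglyMeasurable_fun_sum s fun i _ => hF i
  · exact (Summable.of_norm_bounded (hB.mul_right (g x)) fun i => hFB i x).hasSum

theorem tsum_integral_of_norm_le_mul : ∑' i, ∫ x, F i x ∂m = ∫ x, ∑' i, F i x ∂m := by
  refine (hasSum_integral_of_dominated_convergence (fun i x => B i * g x) hF
    (fun i => Eventually.of_forall (hFB i))
    (Eventually.of_forall fun x => hB.mul_right (g x)) ?_
    (Eventually.of_forall fun x => ?_)).tsum_eq
  · simp_rw [tsum_mul_right]
    exact hg.const_mul _
  · exact (Summable.of_norm_bounded (hB.mul_right (g x)) fun i => hFB i x).hasSum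

end tsum

/-- The quantity `e^{-d(z, η w)}`, the Joukowski parameter of `cosh d(z, η w)`. -/
def expDist (Γ : Subgroup PSL2R) (z w : ℍ) (η : Γ) : ℝ :=
  Real.exp (-dist z (η • w))

section expDist

variable {Γ : Subgroup PSL2R} {z w : ℍ}

theorem expDist_pos (η : Γ) : 0 < expDist Γ z w η := Real.exp_pos _

theorem expDist_lt_one (hzw : proj Γ z ≠ proj Γ w) (η : Γ) : expDist Γ z w η < 1 := by
  rw [expDist, Real.exp_lt_one_iff, neg_lt_zero, dist_pos]
  intro h
  exact hzw (Quotient.sound ⟨η, h.symm⟩)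

theorem joukowski_expDist (η : Γ) :
    joukowski (expDist Γ z w η) = Real.cosh (dist z (η • w)) := by
  rw [joukowski, expDist, Real.exp_neg, inv_inv, Real.cosh_eq, Real.exp_neg, add_comm]

theorem expDist_le_inv_cosh (η : Γ) : expDist Γ z w η ≤ (Real.cosh (dist z (η • w)))⁻¹ := by
  rw [expDist, Real.exp_neg]
  gcongr
  have h_exp : Real.exp (-dist z (η • w)) ≤ Real.exp (dist z (η • w)) :=
    Real.exp_le_exp.2 (neg_le_self dist_nonneg)
  rw [Real.cosh_eq]
  linarith

theorem norm_coshTerm (s : ℂ) (η : Γ) :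
    ‖coshTerm Γ s z w η‖ = Real.cosh (dist z (η • w)) ^ (-s.re) := by
  rw [coshTerm, Complex.norm_cpow_eq_rpow_re_of_pos (Real.cosh_pos _), Complex.neg_re]

end expDist

theorem legendreQNorm_ne_zero {ν : ℂ} (hν : 0 < ν.re) : legendreQNorm ν ≠ 0 := by
  have h_half : 0 < (ν + 1 / 2).re := by
    simp only [Complex.add_re]
    norm_num
    linarith
  refine mul_ne_zero ?_ (mul_ne_zero (div_ne_zero (Complex.Gamma_ne_zero_of_re_pos hν)
    (Complex.Gamma_ne_zero_of_re_pos h_half)) (Complex.Gamma_ne_zero_of_re_pos (by norm_num)))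
  rw [Ne, Complex.cpow_eq_zero_iff]
  simp

theorem legendreQNorm_eq {ν : ℂ} (hν : 1 / 2 < ν.re) :
    legendreQNorm ν = (2 : ℂ) ^ (-ν) * Complex.Gamma ν / Complex.Gamma (ν - 1 / 2) *
      (Complex.Gamma (1 / 2) / (ν - 1 / 2)) := by
  have hne : ν - 1 / 2 ≠ 0 := fun h => by
    rw [sub_eq_zero.1 h] at hν
    norm_num at hν
  rw [legendreQNorm, show ν + 1 / 2 = ν - 1 / 2 + 1 by ring, Complex.Gamma_add_one _ hne]
  field_simp

theorem summable_norm_b_div_factorial {a : ℝ} (h0 : 0 < a) (h1 : a < 1) {ν : ℂ}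
    (hν : 1 ≤ ν.re) :
    Summable fun k : ℕ => ‖b k ν / k.factorial‖ * joukowski a ^ (-(2 * k : ℝ)) := by
  have hJ : 0 < joukowski a := one_pos.trans (one_lt_joukowski h0 h1)
  have hN : 0 < ‖legendreQNorm ν‖ := norm_pos_iff.2 (legendreQNorm_ne_zero (by linarith))
  refine ((hasSum_legendreQ h0 h1 hν).summable.norm.mul_left
    (‖legendreQNorm ν‖⁻¹ * (joukowski a ^ (-ν.re))⁻¹)).congr fun k => ?_
  have hre : (-(ν + 2 * k)).re = -ν.re + -(2 * k : ℝ) := by simp; ring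
  rw [norm_mul, norm_mul, Complex.norm_cpow_eq_rpow_re_of_pos hJ, hre, Real.rpow_add hJ]
  field_simp

theorem aestronglyMeasurable_spectralFun_expDist {Γ : Subgroup PSL2R} {z w : ℍ}
    (hzw : proj Γ z ≠ proj Γ w) {h : ℂ → ℂ} {δ : ℝ} (hd : DifferentiableOn ℂ h (strip δ))
    (hδ : 0 ≤ δ) (η : Γ) :
    AEStronglyMeasurable fun t : ℝ =>
      spectralFun h (expDist Γ z w η) (t + (-(1 / 2 + δ) : ℝ) * Complex.I) :=
  (continuous_spectralFun_line hd (expDist_pos η) (expDist_lt_one hzw η)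
    ⟨le_rfl, by linarith⟩).aestronglyMeasurable

section Group

variable {Γ : Subgroup PSL2R} [Countable Γ] {F : Set ℍ} (hF : IsFundamentalDomain Γ F)
include hF

theorem summable_expDist_rpow {s : ℝ} (hs : 1 < s) (z w : ℍ) :
    Summable fun η : Γ => expDist Γ z w η ^ s := by
  refine (summable_cosh_dist_rpow_neg hF hs z w).of_nonneg_of_le
    (fun η => Real.rpow_nonneg (expDist_pos η).le _) fun η => ?_
  rw [Real.rpow_neg (Real.cosh_pos _).le, ← Real.inv_rpow (Real.cosh_pos _).le]
  exact Real.rpow_le_rpow (expDist_pos η).le (expDist_le_inv_cosh η) (by linarith)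

theorem summable_coshTerm {s : ℂ} (hs : 1 < s.re) (z w : ℍ) : Summable (coshTerm Γ s z w) := by
  refine Summable.of_norm ?_
  simp_rw [norm_coshTerm]
  exact summable_cosh_dist_rpow_neg hF hs z w

variable {z w : ℍ} (hzw : proj Γ z ≠ proj Γ w)
include hzw

theorem exists_expDist_le : ∃ a < 1, ∀ η : Γ, expDist Γ z w η ≤ a := by
  refine exists_lt_forall_le_of_tendsto_cofinite one_pos ?_ (expDist_lt_one hzw)
  have h_sq := (summable_expDist_rpow hF one_lt_two z w).tendsto_cofinite_zero
  have h_root := h_sq.rpow_const (p := 2⁻¹) (Or.inr (by norm_num))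
  rw [Real.zero_rpow (by norm_num)] at h_root
  exact h_root.congr fun η => Real.rpow_rpow_inv (expDist_pos η).le two_ne_zero

theorem summable_b_mul_coshTerm {ν : ℂ} (hν : 1 < ν.re) :
    Summable fun p : ℕ × Γ =>
      b p.1 ν / (p.1.factorial : ℂ) * coshTerm Γ (ν + 2 * p.1) z w p.2 := by
  obtain ⟨a, h1, ha⟩ := exists_expDist_le hF hzw
  have h0 : 0 < a := (expDist_pos 1).trans_le (ha 1)
  have hJ : 0 < joukowski a := one_pos.trans (one_lt_joukowski h0 h1)
  have hle (η : Γ) : joukowski a ≤ Real.cosh (dist z (η • w)) := by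
    rw [← joukowski_expDist]
    exact antitoneOn_joukowski ⟨expDist_pos η, (expDist_lt_one hzw η).le⟩ ⟨h0, h1.le⟩ (ha η)
  refine Summable.of_norm_bounded ((summable_norm_b_div_factorial h0 h1 hν.le).mul_of_nonneg
    (summable_cosh_dist_rpow_neg hF hν z w) (fun k => by positivity) fun η => by positivity) ?_
  rintro ⟨k, η⟩
  have hre : -(ν + 2 * k).re = -(2 * k : ℝ) + -ν.re := by simp
  rw [norm_mul, norm_coshTerm, hre, Real.rpow_add (Real.cosh_pos _), mul_assoc]
  gcongr ?_ * (?_ * ?_)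
  exact Real.rpow_le_rpow_of_nonpos hJ (hle η) (by linarith [(k.cast_nonneg : (0 : ℝ) ≤ k)])

theorem summable_calKTerm {ν : ℂ} (hν : 1 < ν.re) : Summable (calKTerm Γ ν z w) := by
  refine (summable_b_mul_coshTerm hF hzw hν).prod.congr fun k => ?_
  rw [calKTerm, coshKernel, ← tsum_mul_left]

theorem legendreQNorm_mul_calK {ν : ℂ} (hν : 1 < ν.re) :
    legendreQNorm ν * calK Γ ν z w = ∑' η : Γ, legendreQ (expDist Γ z w η) ν := by
  have h_comm := Summable.tsum_comm (f := fun (k : ℕ) (η : Γ) =>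
    b k ν / (k.factorial : ℂ) * coshTerm Γ (ν + 2 * k) z w η) (summable_b_mul_coshTerm hF hzw hν)
  have h_calK : calK Γ ν z w =
      ∑' (k : ℕ) (η : Γ), b k ν / (k.factorial : ℂ) * coshTerm Γ (ν + 2 * k) z w η :=
    tsum_congr fun k => by rw [calKTerm, coshKernel, tsum_mul_left]
  rw [h_calK, ← h_comm, ← tsum_mul_left]
  refine tsum_congr fun η => ?_
  rw [← tsum_mul_left,
    ← (hasSum_legendreQ (expDist_pos η) (expDist_lt_one hzw η) hν.le).tsum_eq, joukowski_expDist]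
  simp only [coshTerm]

theorem integrand_eq (h : ℂ → ℂ) {r : ℂ} (hr : r.im < -(1 / 2)) :
    integrand Γ h z w (1 / 2 + Complex.I * r) = Complex.I / Complex.Gamma (1 / 2) *
      ∑' η : Γ, spectralFun h (expDist Γ z w η) r := by
  set ν := 1 / 2 + Complex.I * r with hν
  have hre : 1 < ν.re := by
    rw [hν, re_one_half_add_I_mul]
    linarith
  have h_sub : ν - 1 / 2 = Complex.I * r := by rw [hν]; ring
  have h_arg : Complex.I * (1 / 2 - ν) = r := by
    linear_combination (-Complex.I) * h_sub - r * Complex.I_sq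
  have hr0 : r ≠ 0 := by
    rintro rfl
    norm_num at hr
  have hG : Complex.Gamma (1 / 2) ≠ 0 := Complex.Gamma_ne_zero_of_re_pos (by norm_num)
  simp only [spectralFun, ← hν]
  rw [tsum_mul_left, ← legendreQNorm_mul_calK hF hzw hre, legendreQNorm_eq (by linarith),
    integrand, h_arg]
  generalize Complex.Gamma (ν - 1 / 2) = G
  rw [h_sub]
  field_simp

theorem integrand_line_eq (h : ℂ → ℂ) {δ : ℝ} (hδ : 0 < δ) (t : ℝ) :
    integrand Γ h z w (((1 + δ : ℝ) : ℂ) + t * Complex.I) =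
      Complex.I / Complex.Gamma (1 / 2) *
        ∑' η : Γ, spectralFun h (expDist Γ z w η) (t + (-(1 / 2 + δ) : ℝ) * Complex.I) := by
  have h_arg : ((1 + δ : ℝ) : ℂ) + t * Complex.I =
      1 / 2 + Complex.I * (t + (-(1 / 2 + δ) : ℝ) * Complex.I) := by
    push_cast
    linear_combination (1 / 2 + δ : ℂ) * Complex.I_sq
  rw [h_arg, integrand_eq hF hzw h (by simpa using hδ)]

variable {h : ℂ → ℂ} {δ : ℝ} (hd : DifferentiableOn ℂ h (strip δ))
  (hO : h =O[Bornology.cobounded ℂ ⊓ 𝓟 (strip δ)] fun r : ℂ => (1 + ‖r‖) ^ (-2 : ℤ))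
  (hδ : 0 < δ)
include hd hO hδ

theorem exists_norm_spectralFun_expDist_le :
    ∃ B : Γ → ℝ, Summable B ∧ ∀ η (t : ℝ),
      ‖spectralFun h (expDist Γ z w η) (t + (-(1 / 2 + δ) : ℝ) * Complex.I)‖ ≤
        B η * (1 + |t|) ^ (-(3 / 2) : ℝ) := by
  obtain ⟨a₀, ha₀, h_le⟩ := exists_expDist_le hF hzw
  obtain ⟨C, -, hC⟩ := exists_norm_spectralFun_le hd hO ha₀
  refine ⟨fun η => C * expDist Γ z w η ^ (1 + δ),
    (summable_expDist_rpow hF (by linarith) z w).mul_left C, fun η t => ?_⟩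
  have h_im : (t + (-(1 / 2 + δ) : ℝ) * Complex.I).im = -(1 / 2 + δ) := by simp
  have h_re : (t + (-(1 / 2 + δ) : ℝ) * Complex.I).re = t := by simp
  have h_bound := hC _ (expDist_pos η) (h_le η) (t + (-(1 / 2 + δ) : ℝ) * Complex.I)
  rw [h_im, h_re, show 1 / 2 - -(1 / 2 + δ) = 1 + δ by ring] at h_bound
  exact h_bound ⟨le_rfl, by linarith⟩

theorem verticalIntegrable_integrand : VerticalIntegrable (integrand Γ h z w) (1 + δ) := by
  obtain ⟨B, hB, h_bound⟩ := exists_norm_spectralFun_expDist_le hF hzw hd hO hδ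
  simp_rw [VerticalIntegrable, integrand_line_eq hF hzw h hδ]
  exact (integrable_tsum_of_norm_le_mul (aestronglyMeasurable_spectralFun_expDist hzw hd hδ.le) hB
    integrable_one_add_abs_rpow h_bound).const_mul _

theorem verticalIntegral_integrand :
    verticalIntegral (integrand Γ h z w) (1 + δ) =
      Complex.I * (Complex.I / Complex.Gamma (1 / 2) * ∑' η : Γ, ∫ t : ℝ,
        spectralFun h (expDist Γ z w η) (t + (-(1 / 2 + δ) : ℝ) * Complex.I)) := by
  obtain ⟨B, hB, h_bound⟩ := exists_norm_spectralFun_expDist_le hF hzw hd hO hδ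
  simp_rw [verticalIntegral, integrand_line_eq hF hzw h hδ]
  rw [integral_const_mul, tsum_integral_of_norm_le_mul
    (aestronglyMeasurable_spectralFun_expDist hzw hd hδ.le) hB integrable_one_add_abs_rpow h_bound]

end Group

theorem mehlerFockKernel_eq {Γ : Subgroup PSL2R} {z w : ℍ} (hzw : proj Γ z ≠ proj Γ w)
    {h : ℂ → ℂ} {δ : ℝ} (hd : DifferentiableOn ℂ h (strip δ))
    (hO : h =O[Bornology.cobounded ℂ ⊓ 𝓟 (strip δ)] fun r : ℂ => (1 + ‖r‖) ^ (-2 : ℤ))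
    (heven : ∀ r : ℝ, h (-r) = h r) (hδ : 0 ≤ δ) :
    mehlerFockKernel Γ h z w = 1 / (4 * Real.pi) * (2 * Complex.I / Real.pi * ∑' η : Γ,
      ∫ t : ℝ, spectralFun h (expDist Γ z w η) (t + (-(1 / 2 + δ) : ℝ) * Complex.I)) := by
  rw [mehlerFockKernel, ← tsum_mul_left (a := 2 * Complex.I / Real.pi)]
  congr 1
  refine tsum_congr fun η => ?_
  rw [← joukowski_expDist,
    integral_legendreP_eq hd hO heven hδ (expDist_pos η) (expDist_lt_one hzw η)]

theorem contour_constant_mul (S : ℂ) :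
    1 / (4 * Real.pi) * (2 * Complex.I / Real.pi * S) =
      1 / (2 * (Real.pi : ℂ) ^ (3 / 2 : ℂ) * Complex.I) *
        (Complex.I * (Complex.I / Complex.Gamma (1 / 2) * S)) := by
  have hpi : (Real.pi : ℂ) ≠ 0 := by exact_mod_cast Real.pi_ne_zero
  have h_pow : (Real.pi : ℂ) ^ (3 / 2 : ℂ) * (Real.pi : ℂ) ^ (1 / 2 : ℂ) = (Real.pi : ℂ) ^ 2 := by
    rw [← Complex.cpow_add _ _ hpi, ← Complex.cpow_natCast]
    norm_num
  have h_ne (s : ℂ) : (Real.pi : ℂ) ^ s ≠ 0 := by simp [Complex.cpow_eq_zero_iff, hpi]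
  have h_ne_three_halves := h_ne (3 / 2)
  have h_ne_half := h_ne (1 / 2)
  rw [Complex.Gamma_one_half_eq]
  field_simp
  linear_combination (4 * S : ℂ) * h_pow

end HypKernel

end

theorem mainTheorem10_general (Γ : Subgroup HypKernel.PSL2R) [Countable Γ]
    {F : Set UpperHalfPlane} (hF : MeasureTheory.IsFundamentalDomain Γ F)
    (h : ℂ → ℂ) (δ : ℝ) (hδ : 0 < δ) (heven : ∀ r : ℝ, h (-r) = h r)
    (hd : DifferentiableOn ℂ h (HypKernel.strip δ))
    (hO : h =O[Bornology.cobounded ℂ ⊓ Filter.principal (HypKernel.strip δ)]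
      fun r : ℂ => (1 + ‖r‖) ^ (-2 : ℤ))
    (z w : UpperHalfPlane) (hzw : HypKernel.proj Γ z ≠ HypKernel.proj Γ w) :
    (∀ ν : ℂ, ν.re = 1 + δ →
      (∀ j : ℕ, Summable (HypKernel.coshTerm Γ (ν + 2 * j) z w)) ∧
      Summable (HypKernel.calKTerm Γ ν z w)) ∧
    HypKernel.VerticalIntegrable (HypKernel.integrand Γ h z w) (1 + δ) ∧
    HypKernel.mehlerFockKernel Γ h z w =
      1 / (2 * (Real.pi : ℂ) ^ (3 / 2 : ℂ) * Complex.I) *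
        HypKernel.verticalIntegral (HypKernel.integrand Γ h z w) (1 + δ) := by
  refine ⟨fun ν hν => ⟨fun j => ?_, HypKernel.summable_calKTerm hF hzw (by linarith)⟩,
    HypKernel.verticalIntegrable_integrand hF hzw hd hO hδ, ?_⟩
  · have hre : (ν + 2 * j).re = 1 + δ + 2 * j := by simp [hν]
    exact HypKernel.summable_coshTerm hF (by linarith [(j.cast_nonneg : (0 : ℝ) ≤ j)]) z w
  · rw [HypKernel.mehlerFockKernel_eq hzw hd hO heven hδ.le,
      HypKernel.verticalIntegral_integrand hF hzw hd hO hδ, HypKernel.contour_constant_mul]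

theorem mainTheorem10
    (Γ : Subgroup HypKernel.PSL2R) (hΓ : HypKernel.IsFuchsianFirstKind Γ)
    (k : ℝ → ℂ) (h : ℂ → ℂ) (hk : HypKernel.HasSelbergTransform k h)
    (ε : ℝ) (hε : 0 < ε)
    (hS1 : ∀ r ∈ HypKernel.strip ε, h (-r) = h r)
    (hS2 : DifferentiableOn ℂ h (HypKernel.strip ε))
    (hbound : h =O[Bornology.cobounded ℂ ⊓ Filter.principal (HypKernel.strip ε)]
      fun r : ℂ => (1 + ‖r‖) ^ (-2 : ℤ))
    (hK : ∀ z w : UpperHalfPlane, HypKernel.proj Γ z ≠ HypKernel.proj Γ w →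
      HypKernel.automorphicKernel Γ k z w = HypKernel.mehlerFockKernel Γ h z w)
    (δ : ℝ) (hδ : 0 < δ) (hδ' : δ < 1 / 2) (hδε : δ ≤ ε)
    (z w : UpperHalfPlane) (hzw : HypKernel.proj Γ z ≠ HypKernel.proj Γ w) :
    (∀ ν : ℂ, ν.re = 1 + δ →
      (∀ j : ℕ, Summable (HypKernel.coshTerm Γ (ν + 2 * j) z w)) ∧
      Summable (HypKernel.calKTerm Γ ν z w)) ∧
    HypKernel.VerticalIntegrable (HypKernel.integrand Γ h z w) (1 + δ) ∧
    HypKernel.automorphicKernel Γ k z w =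
      1 / (2 * (Real.pi : ℂ) ^ (3 / 2 : ℂ) * Complex.I) *
        HypKernel.verticalIntegral (HypKernel.integrand Γ h z w) (1 + δ) := by
  have := hΓ.discrete
  have := HypKernel.countable_of_discreteTopology Γ
  obtain ⟨F, hF, -⟩ := hΓ.finite_volume
  have hsub := HypKernel.strip_mono hδε
  have heven (r : ℝ) : h (-r) = h r := hS1 r (HypKernel.ofReal_mem_strip hε.le r)
  rw [hK z w hzw]
  exact mainTheorem10_general Γ hF h δ hδ heven (hS2.mono hsub)
    (hbound.mono (inf_le_inf_left _ (Filter.principal_mono.2 hsub))) z w hzw
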